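/- **Setup.** Let $d_1,d_2,n$ be natural numbers, $d=\max\{d_1,d_2\}$, and let $X^\natural\in\mathbb R^{d_1\times d_2}$ have rank $r^\natural$. Write $\langle A,B\rangle=\sum_{i,j}A_{ij}B_{ij}$ and $\|A\|_F=\sqrt{\langle A,A\rangle}$. Let $(A_i,y_i)$, $i=1,\dots,n$, be i.i.d., where $A_i\in\mathbb R^{d_1\times d_2}$ has i.i.d. standard Gaussian entries and, given $A_i$, the response $y_i$ follows one of two models: * *matrix sensing*, with noise level $\sigma\ge 0$: $y_i\sim N(\langle A_i,X^\natural\rangle,\sigma^2)$; here $\psi(\theta)=\frac12\theta^2$ and $c(\sigma)=\sigma^2$; * *one-bit matrix sensing*: $y_i\in\{0,1\}$ is Bernoulli with success probability $\frac{\exp\langle A_i,X^\natural\rangle}{1+\exp\langle A_i,X^\natural\rangle}$; here $\psi(\theta)=\log(1+e^\theta)$ and $c(\sigma)=1$. The loss is $\mathcal L(X)=\frac1n\sum_{i=1}^n\big(\psi(\langle X,A_i\rangle)-y_i\langle A_i,X\rangle\big)$. Let $\tau\ge 1$ and let $\mathcal C=\{X:\|X\|_F\le\tau\|X^\natural\|_F\}$.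 For a constant $c_0>0$ put $$\overline B=\sup_{x\in\mathbb R}|\psi''(x)|,\qquad \underline B=\inf_{|x|\le\sqrt{2.4/c_0}\,\tau\|X^\natural\|_F}\psi''(x),\qquad \kappa=1.1\,\overline B/\underline B .$$ **Algorithm (AVPG).** Let $t_0=\lceil 4\kappa\log(4\kappa)\rceil+1$, $\beta=\frac{17}{16}\overline B$, $\eta_0=\frac1{4\kappa}$. Given $X_0\in\mathcal C$ with $\operatorname{rank}X_0\le r^\natural$, put $X_1=X_0$, and for $t=1,2,\dots$ let $\eta=1$ if $t_0$ divides $t$ and $\eta=\eta_0$ otherwise, let $$V_t\in\operatorname*{arg\,min}_{\operatorname{rank}V\le r^\natural,\ V\in\mathcal C}\Big\|X_t-\tfrac1{2\beta\eta}\nabla\mathcal L(X_t)-V\Big\|_F ,\qquad X_{t+1}=(1-\eta)X_t+\eta V_t .$$ Put $h_0=\mathcal L(X_0)-\mathcal L(X^\natural)$. **Claim.** There are universal constants $c,c_0,c_1,c_2>0$ (independent of the model, $\sigma$, $d_1,d_2,n$, $X^\natural$ and $\tau$) such that, whenever $n\ge c_2(\lceil\kappa\log\kappa\rceil+1)\,r^\natural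 d$, the following holds with probability at least $1-\exp(-c_1d)$: for every admissible $X_0$, every choice of the minimizers $V_t$, every $t\ge 0$ and every $\tau_\star\in\arg\min_{1\le k\le t+1}\mathcal L(X_k)$, $$\|X_{\tau_\star}-X^\natural\|_F^2\le c\,\underline B^{-1}\max\Big\{\big(1-\tfrac1{4\kappa}\big)^t(4\kappa)^s h_0,\ \kappa^3\, r^\natural(\log\kappa)\,c(\sigma)\,\frac dn\Big\},$$ where $s$ is the largest integer with $st_0\le t$. -/

import Mathlib

open MeasureTheory ProbabilityTheory
open scoped NNReal

namespace RGLM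

/-! ### Matrices: trace inner product, Frobenius norm, gradient -/

/-- The entrywise (product) σ-algebra on matrices. -/
instance instMeasurableSpaceMatrix {d₁ d₂ : ℕ} :
    MeasurableSpace (Matrix (Fin d₁) (Fin d₂) ℝ) :=
  inferInstanceAs (MeasurableSpace (Fin d₁ → Fin d₂ → ℝ))

/-- The trace inner product `⟨A, B⟩ = ∑ i j, A i j * B i j`. -/
def frobInner {d₁ d₂ : ℕ} (A B : Matrix (Fin d₁) (Fin d₂) ℝ) : ℝ :=
  ∑ i, ∑ j, A i j * B i j

/-- The Frobenius norm. -/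
noncomputable def frobNorm {d₁ d₂ : ℕ} (A : Matrix (Fin d₁) (Fin d₂) ℝ) : ℝ :=
  √(frobInner A A)

/-- The closed Frobenius ball of radius `ξ` centred at the origin. -/
def frobBall (d₁ d₂ : ℕ) (ξ : ℝ) : Set (Matrix (Fin d₁) (Fin d₂) ℝ) :=
  {X | frobNorm X ≤ ξ}

/-- The gradient with respect to the trace inner product, i.e. the matrix of the partial
derivatives `∂L/∂X i j`. -/
noncomputable def matGradient {d₁ d₂ : ℕ} (L : Matrix (Fin d₁) (Fin d₂) ℝ → ℝ)
    (X : Matrix (Fin d₁) (Fin d₂) ℝ) : Matrix (Fin d₁) (Fin d₂) ℝ :=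
  Matrix.of fun i j => lineDeriv ℝ L X (Matrix.single i j (1 : ℝ))

/-! ### The two generalized linear models -/

/-- The two response models: matrix sensing with noise level `σ`, and one-bit matrix sensing. -/
inductive Model where
  | matrixSensing (σ : ℝ≥0) : Model
  | oneBit : Model

namespace Model

/-- The log partition function `ψ`. -/
noncomputable def psi : Model → ℝ → ℝ
  | matrixSensing _ => fun θ => 1 / 2 * θ ^ 2
  | oneBit => fun θ => Real.log (1 + Real.exp θ)

/-- The noise measure `c(σ)`. -/
def noise : Model → ℝ
  | matrixSensing σ => (σ : ℝ) ^ 2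
  | oneBit => 1

/-- The law of the response `y` when `⟨A, X♮⟩ = θ`: `N(θ, σ²)` for matrix sensing, and the
Bernoulli law on `{0, 1}` with success probability `1 / (1 + exp (-θ)) = exp θ / (1 + exp θ)`
for one-bit matrix sensing. -/
noncomputable def responseLaw : Model → ℝ → Measure ℝ
  | matrixSensing σ => fun θ => gaussianReal θ (σ ^ 2)
  | oneBit => fun θ => bernoulliMeasure (1 : ℝ) 0 (unitInterval.sigmoid θ)

lemma measurable_responseLaw (M : Model) : Measurable M.responseLaw := by
  cases M with
  | matrixSensing σ =>
    exact measurable_gaussianReal.comp (measurable_id.prodMk measurable_const)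
  | oneBit =>
    refine Measure.measurable_of_measurable_coe _ fun s hs => ?_
    have hm : Measurable Real.sigmoid := by
      unfold Real.sigmoid
      fun_prop
    have h1 : Measurable fun θ : ℝ => unitInterval.toNNReal (unitInterval.sigmoid θ) := by
      have : Measurable fun θ : ℝ => Real.toNNReal (Real.sigmoid θ) :=
        (hm).real_toNNReal
      convert this using 2 with θ
      ext
      simp [Real.coe_toNNReal _ (Real.sigmoid_nonneg θ)]
      rfl
    have h2 : Measurable fun θ : ℝ =>
        unitInterval.toNNReal (unitInterval.symm (unitInterval.sigmoid θ)) := by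
      have : Measurable fun θ : ℝ => Real.toNNReal (1 - Real.sigmoid θ) :=
        (measurable_const.sub hm).real_toNNReal
      convert this using 2 with θ
      ext
      simp [Real.coe_toNNReal _ (sub_nonneg.2 (Real.sigmoid_le_one θ))]
      rfl
    simp only [responseLaw, bernoulliMeasure_def, Measure.add_apply, Measure.smul_apply,
      ENNReal.smul_def, smul_eq_mul]
    exact (h1.coe_nnreal_ennreal.mul_const _).add (h2.coe_nnreal_ennreal.mul_const _)

instance isProbabilityMeasure_responseLaw (M : Model) (θ : ℝ) :
    IsProbabilityMeasure (M.responseLaw θ) := by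
  cases M <;> simp only [responseLaw] <;> infer_instance

/-- `B̄ = sup_x |ψ''(x)|`. -/
noncomputable def Bsup (M : Model) : ℝ := ⨆ x : ℝ, |iteratedDeriv 2 M.psi x|

/-- `B̲ = inf_{|x| ≤ R} ψ''(x)`. -/
noncomputable def Binf (M : Model) (R : ℝ) : ℝ :=
  sInf (iteratedDeriv 2 M.psi '' {x : ℝ | |x| ≤ R})

/-- `κ = 1.1 * B̄ / B̲`, where the infimum in `B̲` is over `|x| ≤ R`. -/
noncomputable def kappa (M : Model) (R : ℝ) : ℝ := 1.1 * M.Bsup / M.Binf R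

end Model

/-! ### The law of one observation and the loss -/

/-- The law of a `d₁ × d₂` matrix with i.i.d. standard Gaussian entries. -/
noncomputable def gaussianMatrix (d₁ d₂ : ℕ) : Measure (Matrix (Fin d₁) (Fin d₂) ℝ) :=
  Measure.pi fun _ : Fin d₁ => Measure.pi fun _ : Fin d₂ => gaussianReal 0 1

instance isProbabilityMeasure_gaussianMatrix (d₁ d₂ : ℕ) :
    IsProbabilityMeasure (gaussianMatrix d₁ d₂) :=
  inferInstanceAs (IsProbabilityMeasure
    (Measure.pi fun _ : Fin d₁ => Measure.pi fun _ : Fin d₂ => gaussianReal 0 1))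

lemma measurable_frobInner_left {d₁ d₂ : ℕ} (X : Matrix (Fin d₁) (Fin d₂) ℝ) :
    Measurable fun A : Matrix (Fin d₁) (Fin d₂) ℝ => frobInner A X := by
  unfold frobInner
  refine Finset.measurable_sum _ fun i _ => Finset.measurable_sum _ fun j _ => ?_
  exact ((measurable_pi_apply j).comp
    (measurable_pi_apply (X := fun _ : Fin d₁ => Fin d₂ → ℝ) i)).mul_const _

/-- The conditional law of the response given the measurement matrix `A`. -/
noncomputable def responseKernel (M : Model) {d₁ d₂ : ℕ} (Xnat : Matrix (Fin d₁) (Fin d₂) ℝ) :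
    Kernel (Matrix (Fin d₁) (Fin d₂) ℝ) ℝ where
  toFun A := M.responseLaw (frobInner A Xnat)
  measurable' := M.measurable_responseLaw.comp (measurable_frobInner_left Xnat)

instance isMarkovKernel_responseKernel (M : Model) {d₁ d₂ : ℕ}
    (Xnat : Matrix (Fin d₁) (Fin d₂) ℝ) : IsMarkovKernel (responseKernel M Xnat) :=
  ⟨fun A => M.isProbabilityMeasure_responseLaw (frobInner A Xnat)⟩

/-- The joint law of one observation `(A, y)`: `A` has i.i.d. standard Gaussian entries, and
given `A` the response `y` has law `M.responseLaw ⟨A, X♮⟩`. -/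
noncomputable def observationLaw (M : Model) {d₁ d₂ : ℕ} (Xnat : Matrix (Fin d₁) (Fin d₂) ℝ) :
    Measure (Matrix (Fin d₁) (Fin d₂) ℝ × ℝ) :=
  (gaussianMatrix d₁ d₂).compProd (responseKernel M Xnat)

/-- The loss `L(X) = (1/n) ∑ i, (ψ(⟨X, A i⟩) - y i * ⟨A i, X⟩)`. -/
noncomputable def loss (M : Model) {d₁ d₂ n : ℕ} (A : Fin n → Matrix (Fin d₁) (Fin d₂) ℝ)
    (y : Fin n → ℝ) (X : Matrix (Fin d₁) (Fin d₂) ℝ) : ℝ :=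
  1 / (n : ℝ) * ∑ i, (M.psi (frobInner X (A i)) - y i * frobInner (A i) X)

/-! ### The averaged projected gradient method -/

/-- `V` is a value of the regularity projection oracle at `Z`: a minimizer of `‖Z - V‖_F` over
the matrices in `C` of rank at most `r`. -/
def IsRegProj {d₁ d₂ : ℕ} (r : ℕ) (C : Set (Matrix (Fin d₁) (Fin d₂) ℝ))
    (Z V : Matrix (Fin d₁) (Fin d₂) ℝ) : Prop :=
  V.rank ≤ r ∧ V ∈ C ∧ ∀ W : Matrix (Fin d₁) (Fin d₂) ℝ, W.rank ≤ r → W ∈ C →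
    frobNorm (Z - V) ≤ frobNorm (Z - W)

/-- The step size in iteration `t`: it is `1` if `t` is a multiple of `t₀` and `η₀` otherwise. -/
noncomputable def stepSize (η₀ : ℝ) (t₀ t : ℕ) : ℝ := if t₀ ∣ t then 1 else η₀

/-- `X` is a sequence of iterates produced by AVPG for the objective `L`, with some choice of the
values of the projection oracle. The loop runs over `t = 1, 2, …` and is entered with
`X 1 = X 0`, the initial iterate. -/
def IsAVPG {d₁ d₂ : ℕ} (L : Matrix (Fin d₁) (Fin d₂) ℝ → ℝ)
    (C : Set (Matrix (Fin d₁) (Fin d₂) ℝ)) (r : ℕ) (η₀ β : ℝ) (t₀ : ℕ)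
    (X : ℕ → Matrix (Fin d₁) (Fin d₂) ℝ) : Prop :=
  X 0 ∈ C ∧ (X 0).rank ≤ r ∧ X 1 = X 0 ∧
    ∀ t : ℕ, 1 ≤ t → ∃ V : Matrix (Fin d₁) (Fin d₂) ℝ,
      IsRegProj r C (X t - (1 / (2 * β * stepSize η₀ t₀ t)) • matGradient L (X t)) V ∧
      X (t + 1) = (1 - stepSize η₀ t₀ t) • X t + stepSize η₀ t₀ t • V

/-- The period `t₀ = ⌈4 κ log (4 κ)⌉ + 1`. -/
noncomputable def period (κ : ℝ) : ℕ := ⌈4 * κ * Real.log (4 * κ)⌉₊ + 1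

end RGLM

/-! The argument splits into a probabilistic half and a deterministic half, joined by one event on
which the sample behaves well on all matrices of rank at most `q = (t₀ + 1) * r`.

Probability (`exists_good_event`). A matrix of rank at most `q` is a product `U W` with `‖U‖ ≤ 1`
and `‖W‖` its Frobenius norm, so finite nets of log-cardinality `O(q d)` suffice. Chernoff bounds on
the net control three quantities: the sum of `⟨A i, X⟩²` from above, the same sum truncated at
`25‖X‖²` from below, and the noise functional `X ↦ ∑ (y i - ψ'(⟨A i, X♮⟩)) ⟨A i, X⟩`. Bilinearity
carries the bounds from the net to all low-rank matrices.

Geometry of the loss. The upper bound gives restricted smoothness (`loss_bregman_le`). The truncated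
lower bound gives restricted strong convexity (`le_loss_bregman`): `ψ''` is bounded below only on a
bounded interval, and the few measurements that leave it cost at most the truncation level each. The
noise functional bounds the gradient at `X♮`.

Optimization (`IsAVPG.frobNorm_sub_sq_le`). Projecting a gradient step is minimizing a quadratic
upper model over a set containing `X♮`; comparison with `X♮` gives the recursion `IsAVPG.step_le`. A
step of size `1/(4κ)` contracts the gap `L(X t) - L(X♮)` by `1 - 1/(4κ)` but may raise the rank by
`r`. A full step resets the rank to at most `r` and, as long as the gap is above the noise floor,
multiplies it by at most `4κ - 1 = (1 - 1/(4κ)) * 4κ`. Thus each of the `t` steps contributes the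
contraction factor and each of the `s` full steps a further `4κ`. If the gap ever drops below the
floor, so does that of the best iterate, and strong convexity turns the gap into a distance.

The period has a trade-off: the rank between resets, hence the sample size and the noise floor,
grows linearly with it, while `t₀ ≥ 4κ log(4κ)` ensures that the product of factors over one period
is below 1. The stated bound needs only the former. -/

namespace RGLM

/-! ### Nets in finite-dimensional unit balls -/

section Nets

variable {E F G : Type*} [NormedAddCommGroup E] [NormedSpace ℝ E]
  [NormedAddCommGroup F] [NormedSpace ℝ F] [AddCommGroup G] [Module ℝ G]

/-- Volume packing: the balls of radius `ε / 2` about the points are disjoint and lie in the ball of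
radius `1 + ε / 2`; compare Haar measures. -/
theorem card_le_of_separated [FiniteDimensional ℝ E] {ε : ℝ} (hε : 0 < ε) (s : Finset E)
    (hs : ∀ c ∈ s, ‖c‖ ≤ 1) (h : ∀ c ∈ s, ∀ d ∈ s, c ≠ d → ε ≤ ‖c - d‖) :
    (s.card : ℝ) ≤ (1 + 2 / ε) ^ Module.finrank ℝ E := by
  borelize E
  let μ : Measure E := Measure.addHaar
  have hδ : 0 < ε / 2 := by positivity
  have hρ : 0 < 1 + ε / 2 := by positivity
  set A := ⋃ c ∈ s, Metric.ball (c : E) (ε / 2) with hA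
  have D : Set.Pairwise (s : Set E)
      (Function.onFun Disjoint fun c => Metric.ball (c : E) (ε / 2)) := by
    rintro c hc d hd hcd
    apply Metric.ball_disjoint_ball
    rw [dist_eq_norm]
    linarith [h c hc d hd hcd]
  have A_subset : A ⊆ Metric.ball (0 : E) (1 + ε / 2) := by
    refine Set.iUnion₂_subset fun x hx => Metric.ball_subset_ball' ?_
    rw [dist_zero_right]
    linarith [hs x hx]
  have I : (s.card : ENNReal) * ENNReal.ofReal ((ε / 2) ^ Module.finrank ℝ E) *
      μ (Metric.ball 0 1) ≤
      ENNReal.ofReal ((1 + ε / 2) ^ Module.finrank ℝ E) * μ (Metric.ball 0 1) :=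
    calc
      _ = μ A := by
        rw [hA, measure_biUnion_finset D fun c _ => measurableSet_ball]
        simp only [μ.addHaar_ball_of_pos _ hδ, Finset.sum_const, nsmul_eq_mul, mul_assoc]
      _ ≤ μ (Metric.ball (0 : E) (1 + ε / 2)) := measure_mono A_subset
      _ = _ := by simp only [μ.addHaar_ball_of_pos _ hρ]
  have J : (s.card : ENNReal) * ENNReal.ofReal ((ε / 2) ^ Module.finrank ℝ E) ≤
      ENNReal.ofReal ((1 + ε / 2) ^ Module.finrank ℝ E) :=
    (ENNReal.mul_le_mul_iff_left (Metric.measure_ball_pos _ _ zero_lt_one).ne'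
      measure_ball_lt_top.ne).1 I
  have K := ENNReal.toReal_le_of_le_ofReal (pow_nonneg hρ.le _) J
  rw [ENNReal.toReal_mul, ENNReal.toReal_natCast, ENNReal.toReal_ofReal (by positivity)] at K
  rw [show 1 + 2 / ε = (1 + ε / 2) / (ε / 2) by field_simp; ring, div_pow,
    le_div_iff₀ (by positivity)]
  exact K

-- A separated set of maximal cardinality is a net, since an uncovered point could be added to it.
-- The packing bound makes the maximum exist.
variable (E) in
theorem exists_net [FiniteDimensional ℝ E] {ε : ℝ} (hε : 0 < ε) :
    ∃ s : Finset E, (∀ c ∈ s, ‖c‖ ≤ 1) ∧ (s.card : ℝ) ≤ (1 + 2 / ε) ^ Module.finrank ℝ E ∧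
      ∀ x : E, ‖x‖ ≤ 1 → ∃ c ∈ s, ‖x - c‖ ≤ ε := by
  classical
  let Q : ℕ → Prop := fun k => ∃ s : Finset E, s.card = k ∧ (∀ c ∈ s, ‖c‖ ≤ 1) ∧
    ∀ c ∈ s, ∀ d ∈ s, c ≠ d → ε ≤ ‖c - d‖
  have hQ : ∀ k, Q k → k ≤ ⌊(1 + 2 / ε) ^ Module.finrank ℝ E⌋₊ := by
    rintro k ⟨s, rfl, h1, h2⟩
    exact Nat.le_floor (card_le_of_separated hε s h1 h2)
  have h0 : Q 0 := ⟨∅, by simp⟩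
  obtain ⟨s, hcard, h1, h2⟩ := Nat.findGreatest_spec (P := Q)
    (Nat.zero_le ⌊(1 + 2 / ε) ^ Module.finrank ℝ E⌋₊) h0
  refine ⟨s, h1, card_le_of_separated hε s h1 h2, fun x hx => ?_⟩
  by_contra! hcon
  have hxs : x ∉ s := fun hxs => by
    have := hcon x hxs
    simp at this
    linarith
  have hQ' : Q (s.card + 1) := by
    refine ⟨insert x s, Finset.card_insert_of_notMem hxs, ?_, ?_⟩
    · intro c hc
      rcases Finset.mem_insert.1 hc with rfl | hc
      exacts [hx, h1 c hc]
    · intro c hc d hd hcd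
      rcases Finset.mem_insert.1 hc with h3 | h3 <;> rcases Finset.mem_insert.1 hd with h4 | h4
      · exact absurd (h3.trans h4.symm) hcd
      · rw [h3]; exact (hcon d h4).le
      · rw [h4, norm_sub_rev]; exact (hcon c h3).le
      · exact h2 c h3 d h4 hcd
  have := Nat.le_findGreatest (hQ _ hQ') hQ'
  omega

/-- A seminorm on the values of a bilinear map is controlled on a product of unit balls by its
values on a product of nets. -/
theorem seminorm_le_of_nets (b : E →ₗ[ℝ] F →ₗ[ℝ] G) (p : Seminorm ℝ G) {B : ℝ}
    (hB : ∀ x y, ‖x‖ ≤ 1 → ‖y‖ ≤ 1 → p (b x y) ≤ B) {ε : ℝ} (hε : 0 < ε) (hε2 : 2 * ε < 1)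
    {s : Finset E} {t : Finset F} (hs1 : ∀ c ∈ s, ‖c‖ ≤ 1)
    (hs : ∀ x : E, ‖x‖ ≤ 1 → ∃ c ∈ s, ‖x - c‖ ≤ ε) (ht : ∀ x : F, ‖x‖ ≤ 1 → ∃ c ∈ t, ‖x - c‖ ≤ ε)
    {m : ℝ} (hm : ∀ x ∈ s, ∀ y ∈ t, p (b x y) ≤ m) (x : E) (y : F) (hx : ‖x‖ ≤ 1) (hy : ‖y‖ ≤ 1) :
    p (b x y) ≤ m / (1 - 2 * ε) := by
  let V : Set ℝ := {v | ∃ x y, ‖x‖ ≤ 1 ∧ ‖y‖ ≤ 1 ∧ v = p (b x y)}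
  have hbdd : BddAbove V := ⟨B, by rintro _ ⟨x, y, hx, hy, rfl⟩; exact hB x y hx hy⟩
  have hle : ∀ x y, ‖x‖ ≤ 1 → ‖y‖ ≤ 1 → p (b x y) ≤ sSup V := fun x y hx hy =>
    le_csSup hbdd ⟨x, y, hx, hy, rfl⟩
  have hsc : ∀ x y, ‖x‖ ≤ ε → ‖y‖ ≤ 1 → p (b x y) ≤ ε * sSup V := by
    intro x y hx hy
    have h := hle (ε⁻¹ • x) y (by
      rw [norm_smul, norm_inv, Real.norm_of_nonneg hε.le]
      exact (inv_mul_le_iff₀ hε).2 (by simpa using hx)) hy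
    rw [map_smul, LinearMap.smul_apply, map_smul_eq_mul, norm_inv, Real.norm_of_nonneg hε.le] at h
    exact (inv_mul_le_iff₀ hε).1 h
  have hsc' : ∀ x y, ‖x‖ ≤ 1 → ‖y‖ ≤ ε → p (b x y) ≤ ε * sSup V := by
    intro x y hx hy
    have h := hle x (ε⁻¹ • y) hx (by
      rw [norm_smul, norm_inv, Real.norm_of_nonneg hε.le]
      exact (inv_mul_le_iff₀ hε).2 (by simpa using hy))
    rw [map_smul, map_smul_eq_mul, norm_inv, Real.norm_of_nonneg hε.le] at h
    exact (inv_mul_le_iff₀ hε).1 h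
  -- Self-bounding: the error of replacing both factors by net points is again a value of the
  -- bilinear map, scaled by `ε`. The a priori bound `B` is there only to make the supremum finite,
  -- so that this inequality can be solved for it.
  have hS : sSup V ≤ m + 2 * ε * sSup V := by
    refine csSup_le ⟨_, 0, 0, by simp, by simp, rfl⟩ ?_
    rintro _ ⟨x, y, hx, hy, rfl⟩
    obtain ⟨x', hx', hxx⟩ := hs x hx
    obtain ⟨y', hy', hyy⟩ := ht y hy
    have e : b x y = b x' y' + (b (x - x') y + b x' (y - y')) := by
      simp only [map_sub, LinearMap.sub_apply]; abel
    rw [e]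
    have h1 := map_add_le_add p (b x' y') (b (x - x') y + b x' (y - y'))
    have h2 := map_add_le_add p (b (x - x') y) (b x' (y - y'))
    linarith [hm x' hx' y' hy', hsc (x - x') y hxx hy, hsc' x' (y - y') (hs1 x' hx') hyy]
  rw [le_div_iff₀ (by linarith)]
  have := hle x y hx hy
  nlinarith

end Nets


/-! ### The Frobenius norm and low-rank factorizations -/

section Frobenius

variable {d₁ d₂ : ℕ}

/-- The space of lists of `d₂` vectors in `ℝ^d₁`, with the Euclidean norm. -/
abbrev Columns (d₁ d₂ : ℕ) : Type := PiLp 2 fun _ : Fin d₂ => EuclideanSpace ℝ (Fin d₁)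

/-- The list of columns of a matrix. -/
def columns (X : Matrix (Fin d₁) (Fin d₂) ℝ) : Columns d₁ d₂ :=
  WithLp.toLp 2 fun j => WithLp.toLp 2 fun i => X i j

@[simp] lemma columns_apply (X : Matrix (Fin d₁) (Fin d₂) ℝ) (i : Fin d₁) (j : Fin d₂) :
    columns X j i = X i j := rfl

lemma columns_add (X Y : Matrix (Fin d₁) (Fin d₂) ℝ) :
    columns (X + Y) = columns X + columns Y := rfl

lemma columns_sub (X Y : Matrix (Fin d₁) (Fin d₂) ℝ) :
    columns (X - Y) = columns X - columns Y := rfl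

lemma columns_smul (c : ℝ) (X : Matrix (Fin d₁) (Fin d₂) ℝ) :
    columns (c • X) = c • columns X := rfl

lemma frobInner_eq_inner (X Y : Matrix (Fin d₁) (Fin d₂) ℝ) :
    frobInner X Y = inner ℝ (columns X) (columns Y) := by
  simp only [frobInner, PiLp.inner_apply, columns_apply]
  rw [Finset.sum_comm]
  simp [mul_comm]

lemma frobNorm_eq_norm (X : Matrix (Fin d₁) (Fin d₂) ℝ) : frobNorm X = ‖columns X‖ := by
  rw [frobNorm, frobInner_eq_inner, real_inner_self_eq_norm_sq, Real.sqrt_sq (norm_nonneg _)]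

lemma frobNorm_nonneg (X : Matrix (Fin d₁) (Fin d₂) ℝ) : 0 ≤ frobNorm X := Real.sqrt_nonneg _

lemma frobNorm_sq (X : Matrix (Fin d₁) (Fin d₂) ℝ) : frobNorm X ^ 2 = frobInner X X := by
  rw [frobNorm_eq_norm, frobInner_eq_inner, real_inner_self_eq_norm_sq]

lemma frobNorm_add_le (X Y : Matrix (Fin d₁) (Fin d₂) ℝ) :
    frobNorm (X + Y) ≤ frobNorm X + frobNorm Y := by
  simp only [frobNorm_eq_norm, columns_add]; exact norm_add_le _ _

lemma frobNorm_smul (c : ℝ) (X : Matrix (Fin d₁) (Fin d₂) ℝ) :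
    frobNorm (c • X) = |c| * frobNorm X := by
  simp only [frobNorm_eq_norm, columns_smul]; exact norm_smul _ _

lemma frobNorm_eq_zero {X : Matrix (Fin d₁) (Fin d₂) ℝ} : frobNorm X = 0 ↔ X = 0 := by
  rw [frobNorm_eq_norm, norm_eq_zero]
  refine ⟨fun h => ?_, fun h => by subst h; rfl⟩
  ext i j
  rw [← columns_apply X, h]; rfl

lemma frobInner_comm (X Y : Matrix (Fin d₁) (Fin d₂) ℝ) : frobInner X Y = frobInner Y X := by
  simp only [frobInner, mul_comm]

lemma frobInner_add_right (X Y Z : Matrix (Fin d₁) (Fin d₂) ℝ) :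
    frobInner X (Y + Z) = frobInner X Y + frobInner X Z := by
  simp only [frobInner_eq_inner, columns_add, inner_add_right]

lemma frobInner_sub_right (X Y Z : Matrix (Fin d₁) (Fin d₂) ℝ) :
    frobInner X (Y - Z) = frobInner X Y - frobInner X Z := by
  simp only [frobInner_eq_inner, columns_sub, inner_sub_right]

lemma frobInner_smul_right (c : ℝ) (X Y : Matrix (Fin d₁) (Fin d₂) ℝ) :
    frobInner X (c • Y) = c * frobInner X Y := by
  simp only [frobInner_eq_inner, columns_smul, real_inner_smul_right]

lemma rank_add_le (X Y : Matrix (Fin d₁) (Fin d₂) ℝ) : (X + Y).rank ≤ X.rank + Y.rank := by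
  unfold Matrix.rank
  rw [Matrix.mulVecLin_add]
  refine (Submodule.finrank_mono ?_).trans (Submodule.finrank_add_le_finrank_add_finrank _ _)
  rintro _ ⟨v, rfl⟩
  exact Submodule.add_mem_sup ⟨v, rfl⟩ ⟨v, rfl⟩

lemma rank_smul_le (c : ℝ) (X : Matrix (Fin d₁) (Fin d₂) ℝ) : (c • X).rank ≤ X.rank := by
  have : c • X = X * (c • (1 : Matrix (Fin d₂) (Fin d₂) ℝ)) := by simp
  rw [this]; exact Matrix.rank_mul_le_left _ _

lemma rank_sub_le (X Y : Matrix (Fin d₁) (Fin d₂) ℝ) : (X - Y).rank ≤ X.rank + Y.rank := by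
  have : X - Y = X + (-1 : ℝ) • Y := by simp [sub_eq_add_neg]
  rw [this]
  exact (rank_add_le _ _).trans (add_le_add le_rfl (rank_smul_le _ _))

variable (d₁ d₂) in
/-- The matrix with columns `U (W j)`. -/
def factorProd (q : ℕ) :
    (EuclideanSpace ℝ (Fin q) →L[ℝ] EuclideanSpace ℝ (Fin d₁)) →ₗ[ℝ] Columns q d₂ →ₗ[ℝ]
      Matrix (Fin d₁) (Fin d₂) ℝ :=
  LinearMap.mk₂ ℝ (fun U W => Matrix.of fun i j => U (W j) i)
    (fun U U' W => by ext i j; simp) (fun c U W => by ext i j; simp)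
    (fun U W W' => by ext i j; simp) (fun c U W => by ext i j; simp)

lemma frobNorm_factorProd_le {q : ℕ}
    (U : EuclideanSpace ℝ (Fin q) →L[ℝ] EuclideanSpace ℝ (Fin d₁)) (W : Columns q d₂) :
    frobNorm (factorProd d₁ d₂ q U W) ≤ ‖U‖ * ‖W‖ := by
  rw [frobNorm_eq_norm]
  refine le_of_sq_le_sq ?_ (by positivity)
  rw [mul_pow, PiLp.norm_sq_eq_of_L2, PiLp.norm_sq_eq_of_L2, Finset.mul_sum]
  refine Finset.sum_le_sum fun j _ => ?_
  rw [← mul_pow]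
  exact pow_le_pow_left₀ (norm_nonneg _) (U.le_opNorm (W j)) 2

/-- The column span has dimension at most `q`, so it embeds isometrically in `ℝ^q` by some `φ`. The
columns of `W` are the images under `φ` of those of `X`, and `U` is the adjoint of `φ` followed by
inclusion. No singular value decomposition is needed. -/
lemma exists_factorProd {q : ℕ} (X : Matrix (Fin d₁) (Fin d₂) ℝ) (hX : X.rank ≤ q) :
    ∃ (U : EuclideanSpace ℝ (Fin q) →L[ℝ] EuclideanSpace ℝ (Fin d₁)) (W : Columns q d₂),
      ‖U‖ ≤ 1 ∧ ‖W‖ = frobNorm X ∧ factorProd d₁ d₂ q U W = X := by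
  let S : Submodule ℝ (EuclideanSpace ℝ (Fin d₁)) := Submodule.span ℝ (Set.range (columns X))
  have hS : Module.finrank ℝ S ≤ q := by
    refine le_trans (le_of_eq ?_) hX
    rw [Matrix.rank_eq_finrank_span_cols]
    have h := LinearEquiv.finrank_map_eq (WithLp.linearEquiv 2 ℝ (Fin d₁ → ℝ)) S
    rw [← h, Submodule.map_span, ← Set.range_comp]
    rfl
  let b := stdOrthonormalBasis ℝ S
  let e := EuclideanSpace.basisFun (Fin q) ℝ
  let f : S →ₗ[ℝ] EuclideanSpace ℝ (Fin q) :=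
    b.toBasis.constr ℝ fun k => e (Fin.castLE hS k)
  have hf : Orthonormal ℝ (f ∘ b.toBasis) := by
    have : f ∘ b.toBasis = e ∘ Fin.castLE hS := by
      ext1 k; simp [f]
    rw [this]
    exact e.orthonormal.comp _ (Fin.castLE_injective hS)
  let φ : S →ₗᵢ[ℝ] EuclideanSpace ℝ (Fin q) :=
    f.isometryOfOrthonormal (v := b.toBasis) (by simp [b.orthonormal]) hf
  have hmem : ∀ j, columns X j ∈ S := fun j => Submodule.subset_span ⟨j, rfl⟩
  refine ⟨S.subtypeL ∘L (ContinuousLinearMap.adjoint φ.toContinuousLinearMap),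
    WithLp.toLp 2 fun j => φ ⟨columns X j, hmem j⟩, ?_, ?_, ?_⟩
  · refine (ContinuousLinearMap.opNorm_comp_le _ _).trans ?_
    rw [LinearIsometryEquiv.norm_map]
    calc ‖S.subtypeL‖ * ‖φ.toContinuousLinearMap‖ ≤ 1 * 1 := by
          gcongr
          exacts [S.norm_subtypeL_le, φ.norm_toContinuousLinearMap_le]
      _ = 1 := one_mul 1
  · rw [frobNorm_eq_norm, ← sq_eq_sq₀ (norm_nonneg _) (norm_nonneg _), PiLp.norm_sq_eq_of_L2,
      PiLp.norm_sq_eq_of_L2]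
    refine Finset.sum_congr rfl fun j _ => ?_
    simp
  · have key : ∀ x : S, ContinuousLinearMap.adjoint φ.toContinuousLinearMap (φ x) = x := by
      intro x
      refine ext_inner_right ℝ fun y => ?_
      rw [ContinuousLinearMap.adjoint_inner_left]
      exact φ.inner_map_map x y
    ext i j
    change ((ContinuousLinearMap.adjoint φ.toContinuousLinearMap
      (φ ⟨columns X j, hmem j⟩) : S) : EuclideanSpace ℝ (Fin d₁)) i = X i j
    rw [key]
    rfl

end Frobenius


/-! ### Exponential moments of one observation -/

/-- The conditional mean of the response, i.e. the derivative of `ψ`. -/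
noncomputable def Model.mean : Model → ℝ → ℝ
  | .matrixSensing _ => fun θ => θ
  | .oneBit => Real.sigmoid

lemma Model.measurable_mean (M : Model) : Measurable M.mean := by
  cases M with
  | matrixSensing σ => exact measurable_id
  | oneBit => exact continuous_sigmoid.measurable

lemma Model.noise_nonneg (M : Model) : 0 ≤ M.noise := by
  cases M with
  | matrixSensing σ => exact sq_nonneg _
  | oneBit => exact zero_le_one

/-- Rotation invariance of the Gaussian: the characteristic function factors over the entries. It
reduces every moment below to a one-dimensional integral. -/
lemma map_frobInner_gaussianMatrix {d₁ d₂ : ℕ} (X : Matrix (Fin d₁) (Fin d₂) ℝ) :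
    (gaussianMatrix d₁ d₂).map (fun A => frobInner A X) =
      (gaussianReal 0 1).map (fun z => frobNorm X * z) := by
  have hm := measurable_frobInner_left X
  have : IsProbabilityMeasure ((gaussianMatrix d₁ d₂).map (fun A => frobInner A X)) :=
    Measure.isProbabilityMeasure_map hm.aemeasurable
  rw [gaussianReal_map_const_mul]
  refine Measure.ext_of_charFun (funext fun t => ?_)
  rw [charFun_gaussianReal, charFun_apply_real,
    integral_map hm.aemeasurable (by fun_prop)]
  have e : ∀ A : Matrix (Fin d₁) (Fin d₂) ℝ, Complex.exp (t * (frobInner A X : ℝ) * Complex.I) =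
      ∏ i, ∏ j, Complex.exp ((t * X i j : ℝ) * (A i j : ℝ) * Complex.I) := by
    intro A
    simp only [← Complex.exp_sum]
    congr 1
    simp only [frobInner, Complex.ofReal_sum, Finset.mul_sum, Finset.sum_mul]
    refine Finset.sum_congr rfl fun i _ => Finset.sum_congr rfl fun j _ => ?_
    push_cast; ring
  simp_rw [e]
  have e2 := integral_fintype_prod_eq_prod (ι := Fin d₁) (𝕜 := ℂ) (E := fun _ => Fin d₂ → ℝ)
    (μ := fun _ => Measure.pi fun _ : Fin d₂ => gaussianReal 0 1)
    (fun i v => ∏ j, Complex.exp ((t * X i j : ℝ) * (v j : ℝ) * Complex.I))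
  refine e2.trans ?_
  have e3 : ∀ i j, ∫ z : ℝ, Complex.exp ((t * X i j : ℝ) * (z : ℝ) * Complex.I) ∂gaussianReal 0 1 =
      Complex.exp (-((t * X i j : ℝ) ^ 2) / 2) := by
    intro i j
    rw [← charFun_apply_real, charFun_gaussianReal]
    congr 1; push_cast; ring
  have e4 : ∀ i, ∫ v : Fin d₂ → ℝ, ∏ j, Complex.exp ((t * X i j : ℝ) * (v j : ℝ) * Complex.I)
      ∂(Measure.pi fun _ : Fin d₂ => gaussianReal 0 1) =
      ∏ j, Complex.exp (-((t * X i j : ℝ) ^ 2) / 2) := by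
    intro i
    rw [integral_fintype_prod_eq_prod (ι := Fin d₂) (𝕜 := ℂ) (E := fun _ => ℝ)
      (μ := fun _ => gaussianReal 0 1)
      (fun j z => Complex.exp ((t * X i j : ℝ) * (z : ℝ) * Complex.I))]
    exact Finset.prod_congr rfl fun j _ => e3 i j
  rw [Finset.prod_congr rfl fun i _ => e4 i]
  simp only [← Complex.exp_sum]
  congr 1
  have : (frobNorm X ^ 2 : ℝ) = ∑ i, ∑ j, X i j ^ 2 := by
    rw [frobNorm_sq]; simp only [frobInner, sq]
  simp only [NNReal.coe_mk, mul_one, this]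
  push_cast
  simp only [mul_pow, Finset.sum_mul, Finset.sum_div, neg_div, Finset.sum_neg_distrib, mul_zero,
    zero_mul, zero_sub]
  congr 1
  refine Finset.sum_congr rfl fun i _ => Finset.sum_congr rfl fun j _ => ?_
  ring

lemma lintegral_frobInner_gaussianMatrix {d₁ d₂ : ℕ} (X : Matrix (Fin d₁) (Fin d₂) ℝ)
    {f : ℝ → ENNReal} (hf : Measurable f) :
    ∫⁻ A, f (frobInner A X) ∂gaussianMatrix d₁ d₂ =
      ∫⁻ z, f (frobNorm X * z) ∂gaussianReal 0 1 := by
  rw [← lintegral_map hf (measurable_frobInner_left X), map_frobInner_gaussianMatrix,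
    lintegral_map hf (by fun_prop)]

lemma lintegral_exp_sq_gaussianReal {μ : ℝ} (hμ : μ < 1 / 2) :
    ∫⁻ z, ENNReal.ofReal (Real.exp (μ * z ^ 2)) ∂gaussianReal 0 1 =
      ENNReal.ofReal (√(1 - 2 * μ))⁻¹ := by
  have hb : 0 < 1 / 2 - μ := by linarith
  have e : ∀ z : ℝ, gaussianPDFReal 0 1 z * Real.exp (μ * z ^ 2) =
      (√(2 * Real.pi))⁻¹ * Real.exp (-(1 / 2 - μ) * z ^ 2) := by
    intro z
    rw [gaussianPDFReal]
    simp only [NNReal.coe_one, mul_one, sub_zero]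
    rw [mul_assoc, ← Real.exp_add]
    congr 2; ring
  rw [gaussianReal_of_var_ne_zero 0 one_ne_zero,
    lintegral_withDensity_eq_lintegral_mul _ (measurable_gaussianPDF 0 1) (by fun_prop)]
  have e2 : ∀ z : ℝ, (gaussianPDF 0 1 * fun z => ENNReal.ofReal (Real.exp (μ * z ^ 2))) z =
      ENNReal.ofReal ((√(2 * Real.pi))⁻¹ * Real.exp (-(1 / 2 - μ) * z ^ 2)) := by
    intro z
    rw [Pi.mul_apply, gaussianPDF, ← ENNReal.ofReal_mul (gaussianPDFReal_nonneg _ _ _), e]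
  simp_rw [e2]
  rw [← ofReal_integral_eq_lintegral_ofReal ((integrable_exp_neg_mul_sq hb).const_mul _)
    (ae_of_all _ fun z => by positivity), integral_const_mul, integral_gaussian]
  congr 1
  rw [← Real.sqrt_inv, ← Real.sqrt_inv, ← Real.sqrt_mul (by positivity)]
  congr 1
  field_simp

lemma lintegral_observationLaw (M : Model) {d₁ d₂ : ℕ} (Xnat : Matrix (Fin d₁) (Fin d₂) ℝ)
    {f : Matrix (Fin d₁) (Fin d₂) ℝ × ℝ → ENNReal} (hf : Measurable f) :
    ∫⁻ z, f z ∂observationLaw M Xnat =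
      ∫⁻ A, ∫⁻ y, f (A, y) ∂M.responseLaw (frobInner A Xnat) ∂gaussianMatrix d₁ d₂ := by
  rw [observationLaw, Measure.lintegral_compProd hf]
  rfl

lemma lintegral_observationLaw_frobInner (M : Model) {d₁ d₂ : ℕ}
    (Xnat X : Matrix (Fin d₁) (Fin d₂) ℝ) {f : ℝ → ENNReal} (hf : Measurable f) :
    ∫⁻ z, f (frobInner z.1 X) ∂observationLaw M Xnat =
      ∫⁻ z, f (frobNorm X * z) ∂gaussianReal 0 1 := by
  rw [lintegral_observationLaw M Xnat
    (f := fun z => f (frobInner z.1 X)) (hf.comp ((measurable_frobInner_left X).comp measurable_fst)),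
    ← lintegral_frobInner_gaussianMatrix X hf]
  simp

/-- The exponent `3/20` lies above `-log √(3/4)` and below `1.6 / 8`, so Chernoff at level `1.6 n`
decays exponentially. -/
lemma lintegral_exp_sq_le (M : Model) {d₁ d₂ : ℕ} (Xnat X : Matrix (Fin d₁) (Fin d₂) ℝ)
    (hX : frobNorm X ≤ 1) :
    ∫⁻ z, ENNReal.ofReal (Real.exp (1 / 8 * frobInner z.1 X ^ 2)) ∂observationLaw M Xnat ≤
      ENNReal.ofReal (Real.exp (3 / 20)) := by
  rw [lintegral_observationLaw_frobInner M Xnat X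
    (f := fun a => ENNReal.ofReal (Real.exp (1 / 8 * a ^ 2))) (by fun_prop)]
  calc _ ≤ ∫⁻ z, ENNReal.ofReal (Real.exp (1 / 8 * z ^ 2)) ∂gaussianReal 0 1 := by
        refine lintegral_mono fun z => ENNReal.ofReal_le_ofReal (Real.exp_le_exp.2 ?_)
        rw [mul_pow]
        have : frobNorm X ^ 2 ≤ 1 := pow_le_one₀ (frobNorm_nonneg X) hX
        nlinarith [sq_nonneg z]
    _ ≤ _ := by
        rw [lintegral_exp_sq_gaussianReal (by norm_num)]
        refine ENNReal.ofReal_le_ofReal ?_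
        have h1 : (1.15 : ℝ) + 0.01 ≤ Real.exp (3 / 20) := by
          have := Real.quadratic_le_exp_of_nonneg (x := 3 / 20) (by norm_num)
          norm_num at this ⊢
          linarith
        refine le_trans ?_ h1
        rw [inv_le_comm₀ (by positivity) (by norm_num)]
        exact Real.le_sqrt_of_sq_le (by norm_num)

/-- Where the truncation is active, the integrand is at most 1, which `exp (-25/4 + z²/4)`
dominates; elsewhere it is the untruncated Gaussian integrand. The exponent is `0.22675 = 0.3 *
0.7225 + 0.01`, which leaves `exp (-n/100)` in the Chernoff bound at level `0.7225 n`. -/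
lemma lintegral_exp_neg_min_sq_le (M : Model) {d₁ d₂ : ℕ} (Xnat X : Matrix (Fin d₁) (Fin d₂) ℝ)
    (hX : frobNorm X = 1) :
    ∫⁻ z, ENNReal.ofReal (Real.exp (-(3 / 10) * min (frobInner z.1 X ^ 2) 25))
      ∂observationLaw M Xnat ≤ ENNReal.ofReal (Real.exp (-0.22675)) := by
  rw [lintegral_observationLaw_frobInner M Xnat X
    (f := fun a => ENNReal.ofReal (Real.exp (-(3 / 10) * min (a ^ 2) 25))) (by fun_prop)]
  simp only [hX, one_mul]
  calc _ ≤ ∫⁻ z, (ENNReal.ofReal (Real.exp (-(3 / 10) * z ^ 2)) +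
          ENNReal.ofReal (Real.exp (-(25 / 4))) * ENNReal.ofReal (Real.exp (1 / 4 * z ^ 2)))
          ∂gaussianReal 0 1 := by
        refine lintegral_mono fun z => ?_
        simp only
        rw [← ENNReal.ofReal_mul (by positivity), ← ENNReal.ofReal_add (by positivity)
          (by positivity), ← Real.exp_add]
        refine ENNReal.ofReal_le_ofReal ?_
        rcases le_total (z ^ 2) 25 with h | h
        · rw [min_eq_left h]
          linarith [Real.exp_pos (-(25 / 4) + 1 / 4 * z ^ 2)]
        · rw [min_eq_right h]
          have h1 : Real.exp (-(3 / 10) * 25) ≤ 1 := Real.exp_le_one_iff.2 (by norm_num)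
          have h2 : 1 ≤ Real.exp (-(25 / 4) + 1 / 4 * z ^ 2) :=
            Real.one_le_exp (by linarith)
          linarith [Real.exp_pos (-(3 / 10) * z ^ 2)]
    _ ≤ _ := by
        rw [lintegral_add_left (by fun_prop), lintegral_const_mul _ (by fun_prop),
          lintegral_exp_sq_gaussianReal (by norm_num), lintegral_exp_sq_gaussianReal (by norm_num),
          ← ENNReal.ofReal_mul (by positivity), ← ENNReal.ofReal_add (by positivity)
          (by positivity)]
        refine ENNReal.ofReal_le_ofReal ?_
        have h1 : (√(1 - 2 * -(3 / 10)))⁻¹ ≤ (0.7910 : ℝ) := by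
          rw [inv_le_comm₀ (by positivity) (by norm_num)]
          exact Real.le_sqrt_of_sq_le (by norm_num)
        have h2 : (√(1 - 2 * (1 / 4)))⁻¹ ≤ (1.42 : ℝ) := by
          rw [inv_le_comm₀ (by positivity) (by norm_num)]
          exact Real.le_sqrt_of_sq_le (by norm_num)
        have h3 : Real.exp (-(25 / 4)) ≤ 1 / 400 := by
          have h4 : (2.718 : ℝ) ≤ Real.exp 1 := by linarith [Real.exp_one_gt_d9]
          have h5 : Real.exp (-(25 / 4)) ≤ (Real.exp 1 ^ 6)⁻¹ := by
            rw [← Real.exp_nat_mul, ← Real.exp_neg]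
            exact Real.exp_le_exp.2 (by norm_num)
          have h6 : (2.718 : ℝ) ^ 6 ≤ Real.exp 1 ^ 6 := pow_le_pow_left₀ (by norm_num) h4 6
          refine h5.trans ?_
          rw [inv_le_comm₀ (by positivity) (by norm_num)]
          refine le_trans ?_ h6
          norm_num
        have h7 : (0.7960 : ℝ) ≤ Real.exp (-0.22675) := by
          have := Real.exp_bound' (x := 0.22675) (by norm_num) (by norm_num) (n := 4) (by norm_num)
          rw [Real.exp_neg, le_inv_comm₀ (by norm_num) (by positivity)]
          refine this.trans ?_
          norm_num [Finset.sum_range_succ, Nat.factorial]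
        have h8 : Real.exp (-(25 / 4)) * (√(1 - 2 * (1 / 4)))⁻¹ ≤ 1 / 400 * 1.42 := by gcongr
        norm_num at h1 h8 h7 ⊢
        linarith

/-- The centred response is sub-Gaussian with variance proxy `c(σ)`: an equality for the normal law,
Hoeffding's lemma (proxy `1/4`) for the Bernoulli law. -/
lemma lintegral_exp_response_le (M : Model) (θ s : ℝ) :
    ∫⁻ y, ENNReal.ofReal (Real.exp (s * (y - M.mean θ))) ∂M.responseLaw θ ≤
      ENNReal.ofReal (Real.exp (M.noise * s ^ 2 / 2)) := by
  cases M with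
  | matrixSensing σ =>
    simp only [Model.responseLaw, Model.mean, Model.noise]
    have h := mgf_id_gaussianReal (μ := θ) (v := σ ^ 2)
    have h1 := congrFun h s
    rw [mgf] at h1
    have hi := integrable_exp_mul_gaussianReal (μ := θ) (v := σ ^ 2) s
    have e : ∀ y : ℝ, Real.exp (s * (y - θ)) = Real.exp (-(s * θ)) * Real.exp (s * y) := by
      intro y; rw [← Real.exp_add]; congr 1; ring
    simp_rw [e]
    rw [← ofReal_integral_eq_lintegral_ofReal (hi.const_mul _)
      (ae_of_all _ fun z => by positivity), integral_const_mul]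
    refine ENNReal.ofReal_le_ofReal ?_
    simp only [id] at h1
    rw [h1, ← Real.exp_add]
    refine Real.exp_le_exp.2 (le_of_eq ?_)
    push_cast; ring
  | oneBit =>
    simp only [Model.responseLaw, Model.mean, Model.noise]
    set p := unitInterval.sigmoid θ with hp
    have hmem : ∀ᵐ y ∂bernoulliMeasure (1 : ℝ) 0 p, y ∈ Set.Icc (0 : ℝ) 1 := by
      rw [bernoulliMeasure_def, ae_add_measure_iff]
      constructor
      · refine Measure.ae_smul_measure ?_ _
        simp [ae_dirac_eq]
      · refine Measure.ae_smul_measure ?_ _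
        simp [ae_dirac_eq]
    have hmean : ∫ y, y ∂bernoulliMeasure (1 : ℝ) 0 p = Real.sigmoid θ := by
      rw [integral_bernoulliMeasure]
      simp only [hp, smul_eq_mul, mul_one, mul_zero, add_zero]
      rfl
    have hsg := hasSubgaussianMGF_of_mem_Icc (μ := bernoulliMeasure (1 : ℝ) 0 p) (X := fun y => y)
      aemeasurable_id hmem
    rw [hmean] at hsg
    have h1 := hsg.mgf_le s
    rw [← ofReal_integral_eq_lintegral_ofReal (hsg.integrable_exp_mul s)
      (ae_of_all _ fun z => by positivity)]
    refine ENNReal.ofReal_le_ofReal (h1.trans (Real.exp_le_exp.2 ?_))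
    norm_num
    nlinarith [sq_nonneg s]

lemma inv_sqrt_one_sub_le_exp {x : ℝ} (h0 : 0 ≤ x) (h1 : x ≤ 1 / 2) :
    (√(1 - x))⁻¹ ≤ Real.exp x := by
  rw [inv_le_comm₀ (Real.sqrt_pos.2 (by linarith)) (Real.exp_pos _), ← Real.exp_neg]
  refine Real.le_sqrt_of_sq_le ?_
  rw [← Real.exp_nat_mul, show ((2 : ℕ) : ℝ) * -x = -(2 * x) by push_cast; ring, Real.exp_neg]
  have h := Real.quadratic_le_exp_of_nonneg (x := 2 * x) (by linarith)
  rw [inv_le_comm₀ (Real.exp_pos _) (by linarith)]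
  refine le_trans ?_ h
  rw [inv_le_iff_one_le_mul₀ (by linarith)]
  nlinarith [mul_nonneg h0 (mul_nonneg h0 h0), mul_nonneg h0 (sub_nonneg.2 h1),
    mul_nonneg (mul_nonneg h0 h0) (sub_nonneg.2 h1)]

/-- Integrating out `y` given `A` leaves the exponential of a squared Gaussian. The product is only
sub-exponential, hence the restriction on `s`. -/
lemma lintegral_exp_noise_le (M : Model) {d₁ d₂ : ℕ} (Xnat X : Matrix (Fin d₁) (Fin d₂) ℝ)
    (hX : frobNorm X ≤ 1) {s : ℝ} (hs : s ^ 2 * M.noise ≤ 1 / 2) :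
    ∫⁻ z, ENNReal.ofReal (Real.exp (s * ((z.2 - M.mean (frobInner z.1 Xnat)) * frobInner z.1 X)))
      ∂observationLaw M Xnat ≤ ENNReal.ofReal (Real.exp (s ^ 2 * M.noise)) := by
  have hc := M.noise_nonneg
  have hm := (M.measurable_mean.comp ((measurable_frobInner_left Xnat).comp measurable_fst) :
    Measurable fun z : Matrix (Fin d₁) (Fin d₂) ℝ × ℝ => M.mean (frobInner z.1 Xnat))
  have hm' := ((measurable_frobInner_left X).comp measurable_fst :
    Measurable fun z : Matrix (Fin d₁) (Fin d₂) ℝ × ℝ => frobInner z.1 X)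
  rw [lintegral_observationLaw M Xnat
    (f := fun z => ENNReal.ofReal (Real.exp (s * ((z.2 - M.mean (frobInner z.1 Xnat)) *
      frobInner z.1 X)))) (by fun_prop)]
  calc _ ≤ ∫⁻ A, ENNReal.ofReal (Real.exp (M.noise * (s * frobInner A X) ^ 2 / 2))
          ∂gaussianMatrix d₁ d₂ := by
        refine lintegral_mono fun A => ?_
        refine le_trans (le_of_eq ?_) (lintegral_exp_response_le M (frobInner A Xnat)
          (s * frobInner A X))
        refine lintegral_congr fun y => ?_
        congr 2; ring
    _ = ∫⁻ z, ENNReal.ofReal (Real.exp (M.noise * (s * (frobNorm X * z)) ^ 2 / 2))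
          ∂gaussianReal 0 1 :=
        lintegral_frobInner_gaussianMatrix X
          (f := fun a => ENNReal.ofReal (Real.exp (M.noise * (s * a) ^ 2 / 2))) (by fun_prop)
    _ ≤ ∫⁻ z, ENNReal.ofReal (Real.exp (s ^ 2 * M.noise / 2 * z ^ 2)) ∂gaussianReal 0 1 := by
        refine lintegral_mono fun z => ENNReal.ofReal_le_ofReal (Real.exp_le_exp.2 ?_)
        have h1 : frobNorm X ^ 2 ≤ 1 := pow_le_one₀ (frobNorm_nonneg X) hX
        have h2 : 0 ≤ s ^ 2 * M.noise * z ^ 2 := by positivity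
        nlinarith
    _ ≤ _ := by
        rw [lintegral_exp_sq_gaussianReal (by linarith)]
        refine ENNReal.ofReal_le_ofReal ?_
        rw [show 1 - 2 * (s ^ 2 * M.noise / 2) = 1 - s ^ 2 * M.noise by ring]
        exact inv_sqrt_one_sub_le_exp (by positivity) hs


/-! ### From nets to all low-rank matrices -/

section Sampling

variable {d₁ d₂ n q : ℕ}

/-- The vector of measurements `⟨A i, X⟩`, linear in `X`. -/
noncomputable def sampling (A : Fin n → Matrix (Fin d₁) (Fin d₂) ℝ) :
    Matrix (Fin d₁) (Fin d₂) ℝ →ₗ[ℝ] EuclideanSpace ℝ (Fin n) where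
  toFun X := WithLp.toLp 2 fun i => frobInner (A i) X
  map_add' X Y := by ext i; simp [frobInner_add_right]
  map_smul' c X := by ext i; simp [frobInner_smul_right]

@[simp] lemma sampling_apply (A : Fin n → Matrix (Fin d₁) (Fin d₂) ℝ)
    (X : Matrix (Fin d₁) (Fin d₂) ℝ) (i : Fin n) : sampling A X i = frobInner (A i) X := rfl

lemma norm_sampling_sq (A : Fin n → Matrix (Fin d₁) (Fin d₂) ℝ)
    (X : Matrix (Fin d₁) (Fin d₂) ℝ) : ‖sampling A X‖ ^ 2 = ∑ i, frobInner (A i) X ^ 2 := by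
  simp [EuclideanSpace.norm_sq_eq]

/-- The functional `X ↦ ∑ i, e i * ⟨A i, X⟩`. -/
noncomputable def weightedSampling (A : Fin n → Matrix (Fin d₁) (Fin d₂) ℝ) (e : Fin n → ℝ) :
    Matrix (Fin d₁) (Fin d₂) ℝ →ₗ[ℝ] ℝ where
  toFun X := ∑ i, e i * frobInner (A i) X
  map_add' X Y := by simp [frobInner_add_right, mul_add, Finset.sum_add_distrib]
  map_smul' c X := by
    simp only [frobInner_smul_right, smul_eq_mul, Finset.mul_sum, RingHom.id_apply]
    exact Finset.sum_congr rfl fun i _ => by ring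

/-- Supplies the a priori bound for the net argument; the size of `B` is immaterial. -/
lemma exists_norm_le_frobNorm {V : Type*} [NormedAddCommGroup V] [NormedSpace ℝ V]
    (T : Matrix (Fin d₁) (Fin d₂) ℝ →ₗ[ℝ] V) :
    ∃ B : ℝ, 0 ≤ B ∧ ∀ X, ‖T X‖ ≤ B * frobNorm X := by
  refine ⟨∑ i, ∑ j, ‖T (Matrix.single i j 1)‖, by positivity, fun X => ?_⟩
  have hX : ∀ i j, |X i j| ≤ frobNorm X := fun i j => by
    rw [frobNorm_eq_norm]
    exact (PiLp.norm_apply_le (columns X j) i).trans (PiLp.norm_apply_le (columns X) j)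
  conv_lhs => rw [Matrix.matrix_eq_sum_single X]
  simp only [map_sum, Finset.sum_mul]
  refine (norm_sum_le _ _).trans (Finset.sum_le_sum fun i _ => (norm_sum_le _ _).trans
    (Finset.sum_le_sum fun j _ => ?_))
  rw [show Matrix.single i j (X i j) = X i j • Matrix.single i j (1 : ℝ) by simp, map_smul,
    norm_smul, Real.norm_eq_abs, mul_comm]
  exact mul_le_mul_of_nonneg_left (hX i j) (norm_nonneg _)

variable {s : Finset (EuclideanSpace ℝ (Fin q) →L[ℝ] EuclideanSpace ℝ (Fin d₁))}
  {t : Finset (Columns q d₂)}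

/-- Here `0.98 = 1 - 2/100`. The homogeneous form is needed for the small differences between a
factor and its net point. -/
lemma norm_factorProd_le_of_nets {V : Type*} [NormedAddCommGroup V] [NormedSpace ℝ V]
    (T : Matrix (Fin d₁) (Fin d₂) ℝ →ₗ[ℝ] V) (hs1 : ∀ c ∈ s, ‖c‖ ≤ 1)
    (hs : ∀ x, ‖x‖ ≤ 1 → ∃ c ∈ s, ‖x - c‖ ≤ 1 / 100)
    (ht : ∀ x, ‖x‖ ≤ 1 → ∃ c ∈ t, ‖x - c‖ ≤ 1 / 100) {m : ℝ}
    (hm : ∀ U ∈ s, ∀ W ∈ t, ‖T (factorProd d₁ d₂ q U W)‖ ≤ m)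
    (U : EuclideanSpace ℝ (Fin q) →L[ℝ] EuclideanSpace ℝ (Fin d₁)) (W : Columns q d₂) :
    ‖T (factorProd d₁ d₂ q U W)‖ ≤ m / 0.98 * (‖U‖ * ‖W‖) := by
  obtain ⟨B, hB0, hB⟩ := exists_norm_le_frobNorm T
  have key := seminorm_le_of_nets (factorProd d₁ d₂ q) ((normSeminorm ℝ V).comp T) (B := B)
    (fun U W hU hW => (hB _).trans (by
      have := (frobNorm_factorProd_le U W).trans (mul_le_one₀ hU (norm_nonneg _) hW)
      nlinarith)) (ε := 1 / 100) (by norm_num) (by norm_num) hs1 hs ht (m := m) hm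
  rcases eq_or_ne U 0 with rfl | hU
  · simp
  rcases eq_or_ne W 0 with rfl | hW
  · simp
  have hU' := norm_pos_iff.2 hU
  have hW' := norm_pos_iff.2 hW
  have h := key (‖U‖⁻¹ • U) (‖W‖⁻¹ • W) (by rw [norm_smul]; simp [hU'.ne'])
    (by rw [norm_smul]; simp [hW'.ne'])
  simp only [Seminorm.comp_apply, map_smul, LinearMap.smul_apply, coe_normSeminorm, norm_smul,
    norm_inv, norm_norm] at h
  rw [← mul_assoc, ← mul_inv, inv_mul_le_iff₀ (by positivity)] at h
  norm_num at h ⊢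
  linarith

/-- The nets are fine enough for upper bounds on them to extend to all low-rank matrices. -/
lemma norm_le_of_nets {V : Type*} [NormedAddCommGroup V] [NormedSpace ℝ V]
    (T : Matrix (Fin d₁) (Fin d₂) ℝ →ₗ[ℝ] V) (hs1 : ∀ c ∈ s, ‖c‖ ≤ 1)
    (hs : ∀ x, ‖x‖ ≤ 1 → ∃ c ∈ s, ‖x - c‖ ≤ 1 / 100)
    (ht : ∀ x, ‖x‖ ≤ 1 → ∃ c ∈ t, ‖x - c‖ ≤ 1 / 100) {m : ℝ} (hm0 : 0 ≤ m)
    (hm : ∀ U ∈ s, ∀ W ∈ t, ‖T (factorProd d₁ d₂ q U W)‖ ≤ m)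
    (X : Matrix (Fin d₁) (Fin d₂) ℝ) (hX : X.rank ≤ q) :
    ‖T X‖ ≤ m / 0.98 * frobNorm X := by
  obtain ⟨U, W, hU, hW, rfl⟩ := exists_factorProd X hX
  refine (norm_factorProd_le_of_nets T hs1 hs ht hm U W).trans ?_
  rw [← hW]
  have : ‖U‖ * ‖W‖ ≤ 1 * ‖W‖ := by gcongr
  rw [one_mul] at this
  gcongr

lemma min_abs_sq (a : ℝ) : min |a| 5 ^ 2 = min (a ^ 2) 25 := by
  rw [← sq_abs a]
  rcases le_total |a| 5 with h | h
  · rw [min_eq_left h, min_eq_left (by nlinarith [abs_nonneg a])]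
  · rw [min_eq_right h, min_eq_right (by nlinarith)]; norm_num

lemma norm_truncated_sq (A : Fin n → Matrix (Fin d₁) (Fin d₂) ℝ)
    (X : Matrix (Fin d₁) (Fin d₂) ℝ) :
    ‖(WithLp.toLp 2 fun i => min |frobInner (A i) X| 5 : EuclideanSpace ℝ (Fin n))‖ ^ 2 =
      ∑ i, min (frobInner (A i) X ^ 2) 25 := by
  simp [EuclideanSpace.norm_sq_eq, min_abs_sq]

/-- The truncated sum is not a seminorm, but it is the squared length of the vector of `min |⟨A i,
X⟩| 5`, which is 1-Lipschitz in the measurements. The net gives `0.85 √n` after normalization,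
rescaling costs the factor `0.98`, and the perturbation costs `0.03 √n`; what is left exceeds `0.8
√n`, and `0.8² = 16/25`. -/
lemma le_sum_min_of_nets_unit (A : Fin n → Matrix (Fin d₁) (Fin d₂) ℝ) (hs1 : ∀ c ∈ s, ‖c‖ ≤ 1)
    (hs : ∀ x, ‖x‖ ≤ 1 → ∃ c ∈ s, ‖x - c‖ ≤ 1 / 100)
    (ht : ∀ x, ‖x‖ ≤ 1 → ∃ c ∈ t, ‖x - c‖ ≤ 1 / 100)
    (hup : ∀ U ∈ s, ∀ W ∈ t, ‖sampling A (factorProd d₁ d₂ q U W)‖ ≤ √(1.6 * n))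
    (hlow : ∀ U ∈ s, ∀ W ∈ t, frobNorm (factorProd d₁ d₂ q U W) ≠ 0 →
      0.7225 * n ≤ ∑ i, min (frobInner (A i) ((frobNorm (factorProd d₁ d₂ q U W))⁻¹ •
        factorProd d₁ d₂ q U W) ^ 2) 25)
    (X : Matrix (Fin d₁) (Fin d₂) ℝ) (hX : X.rank ≤ q) (hX1 : frobNorm X = 1) :
    16 / 25 * (n : ℝ) ≤ ∑ i, min (frobInner (A i) X ^ 2) 25 := by
  have hn0 := Real.sqrt_nonneg (n : ℝ)
  obtain ⟨U, W, hU, hW, rfl⟩ := exists_factorProd X hX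
  rw [hX1] at hW
  obtain ⟨U', hU's, hUU⟩ := hs U hU
  obtain ⟨W', hW't, hWW⟩ := ht W hW.le
  set X := factorProd d₁ d₂ q U W with hXdef
  set X' := factorProd d₁ d₂ q U' W' with hX'def
  have e : X = X' + (factorProd d₁ d₂ q (U - U') W + factorProd d₁ d₂ q U' (W - W')) := by
    simp only [map_sub, LinearMap.sub_apply, hXdef, hX'def]; abel
  set D₁ := factorProd d₁ d₂ q (U - U') W
  set D₂ := factorProd d₁ d₂ q U' (W - W')
  have hb1 : ‖U - U'‖ * ‖W‖ ≤ 1 / 100 := by rw [hW, mul_one]; exact hUU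
  have hb2 : ‖U'‖ * ‖W - W'‖ ≤ 1 / 100 := by
    have := hs1 U' hU's
    calc _ ≤ 1 * (1 / 100 : ℝ) := by gcongr
      _ = _ := one_mul _
  have hX'n : 0.98 ≤ frobNorm X' := by
    have h1 := frobNorm_factorProd_le (U - U') W
    have h2 := frobNorm_factorProd_le U' (W - W')
    have h3 := frobNorm_add_le X' (D₁ + D₂)
    have h4 := frobNorm_add_le D₁ D₂
    rw [← e, hX1] at h3
    linarith
  have hD : ‖sampling A (D₁ + D₂)‖ ≤ 0.03 * √n := by
    have h1 := norm_factorProd_le_of_nets (sampling A) hs1 hs ht hup (U - U') W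
    have h2 := norm_factorProd_le_of_nets (sampling A) hs1 hs ht hup U' (W - W')
    have h3 := norm_add_le (sampling A D₁) (sampling A D₂)
    rw [← map_add] at h3
    have h4 : √(1.6 * n) / 0.98 ≤ 1.3 * √n := by
      rw [Real.sqrt_mul (by norm_num)]
      have : √1.6 ≤ 1.27 := Real.sqrt_le_iff.2 (by norm_num)
      rw [div_le_iff₀ (by norm_num)]
      nlinarith
    have h5 : √(1.6 * n) / 0.98 * (‖U - U'‖ * ‖W‖) ≤ 1.3 * √n * (1 / 100) := by gcongr
    have h6 : √(1.6 * n) / 0.98 * (‖U'‖ * ‖W - W'‖) ≤ 1.3 * √n * (1 / 100) := by gcongr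
    linarith
  have hlow' := hlow U' hU's W' hW't (by rw [← hX'def]; linarith)
  rw [← hX'def] at hlow'
  set v : Matrix (Fin d₁) (Fin d₂) ℝ → EuclideanSpace ℝ (Fin n) := fun Y =>
    WithLp.toLp 2 fun i => min |frobInner (A i) Y| 5 with hv
  have hv1 : 0.85 * √n ≤ ‖v ((frobNorm X')⁻¹ • X')‖ := by
    refine le_of_sq_le_sq ?_ (norm_nonneg _)
    rw [hv, norm_truncated_sq, mul_pow, Real.sq_sqrt (Nat.cast_nonneg n)]
    norm_num at hlow' ⊢
    exact hlow'
  have hmono : ∀ x y : EuclideanSpace ℝ (Fin n), (∀ i, 0 ≤ x i) → (∀ i, x i ≤ y i) → ‖x‖ ≤ ‖y‖ := by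
    intro x y h0 h
    refine le_of_sq_le_sq ?_ (norm_nonneg _)
    rw [EuclideanSpace.real_norm_sq_eq, EuclideanSpace.real_norm_sq_eq]
    exact Finset.sum_le_sum fun i _ => pow_le_pow_left₀ (h0 i) (h i) 2
  have hv2 : ‖(0.98 : ℝ) • v ((frobNorm X')⁻¹ • X')‖ ≤ ‖v X'‖ := by
    refine hmono _ _ (fun i => ?_) fun i => ?_
    · simp only [hv, PiLp.smul_apply, smul_eq_mul]
      positivity
    · simp only [hv, PiLp.smul_apply, smul_eq_mul, frobInner_smul_right, abs_mul, abs_inv,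
        abs_of_nonneg (frobNorm_nonneg X')]
      have hp : 0 < frobNorm X' := by linarith
      refine le_min ?_ ?_
      · have h1 : (frobNorm X')⁻¹ * |frobInner (A i) X'| * frobNorm X' = |frobInner (A i) X'| := by
          field_simp
        have h2 : 0 ≤ (frobNorm X')⁻¹ * |frobInner (A i) X'| := by positivity
        have h3 := min_le_left ((frobNorm X')⁻¹ * |frobInner (A i) X'|) 5
        nlinarith
      · have h3 := min_le_right ((frobNorm X')⁻¹ * |frobInner (A i) X'|) 5
        linarith
  let w : EuclideanSpace ℝ (Fin n) := WithLp.toLp 2 fun i => |frobInner (A i) (D₁ + D₂)|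
  have hw : ‖w‖ = ‖sampling A (D₁ + D₂)‖ := by
    rw [← sq_eq_sq₀ (norm_nonneg _) (norm_nonneg _), norm_sampling_sq,
      EuclideanSpace.real_norm_sq_eq]
    simp [w]
  have hv3 : ‖v X'‖ ≤ ‖v X + w‖ := by
    refine hmono _ _ (fun i => ?_) fun i => ?_
    · simp only [hv]; positivity
    · simp only [hv, w, PiLp.add_apply]
      have h1 : frobInner (A i) X = frobInner (A i) X' + frobInner (A i) (D₁ + D₂) := by
        conv_lhs => rw [e]
        rw [frobInner_add_right]
      have h2 : |frobInner (A i) X'| ≤ |frobInner (A i) X| + |frobInner (A i) (D₁ + D₂)| := by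
        have h3 := abs_sub (frobInner (A i) X) (frobInner (A i) (D₁ + D₂))
        rwa [show frobInner (A i) X - frobInner (A i) (D₁ + D₂) = frobInner (A i) X' by
          linarith] at h3
      rcases le_total |frobInner (A i) X| 5 with h | h
      · rw [min_eq_left h]
        exact (min_le_left _ _).trans h2
      · rw [min_eq_right h]
        have := min_le_right |frobInner (A i) X'| 5
        linarith [abs_nonneg (frobInner (A i) (D₁ + D₂))]
  have hv4 := norm_add_le (v X) w
  rw [norm_smul, Real.norm_of_nonneg (by norm_num)] at hv2
  have hfin : 4 / 5 * √n ≤ ‖v X‖ := by linarith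
  have h5 := pow_le_pow_left₀ (by positivity) hfin 2
  rw [hv, norm_truncated_sq, mul_pow, Real.sq_sqrt (Nat.cast_nonneg n)] at h5
  norm_num at h5 ⊢
  exact h5

lemma le_sum_min_of_nets (A : Fin n → Matrix (Fin d₁) (Fin d₂) ℝ) (hs1 : ∀ c ∈ s, ‖c‖ ≤ 1)
    (hs : ∀ x, ‖x‖ ≤ 1 → ∃ c ∈ s, ‖x - c‖ ≤ 1 / 100)
    (ht : ∀ x, ‖x‖ ≤ 1 → ∃ c ∈ t, ‖x - c‖ ≤ 1 / 100)
    (hup : ∀ U ∈ s, ∀ W ∈ t, ‖sampling A (factorProd d₁ d₂ q U W)‖ ≤ √(1.6 * n))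
    (hlow : ∀ U ∈ s, ∀ W ∈ t, frobNorm (factorProd d₁ d₂ q U W) ≠ 0 →
      0.7225 * n ≤ ∑ i, min (frobInner (A i) ((frobNorm (factorProd d₁ d₂ q U W))⁻¹ •
        factorProd d₁ d₂ q U W) ^ 2) 25)
    (X : Matrix (Fin d₁) (Fin d₂) ℝ) (hX : X.rank ≤ q) :
    16 / 25 * (n : ℝ) * frobNorm X ^ 2 ≤
      ∑ i, min (frobInner (A i) X ^ 2) (25 * frobNorm X ^ 2) := by
  rcases eq_or_ne (frobNorm X) 0 with h0 | h0
  · rw [h0]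
    refine le_trans (by norm_num) (Finset.sum_nonneg fun i _ => ?_)
    exact le_min (sq_nonneg _) (by norm_num)
  have hp : 0 < frobNorm X := lt_of_le_of_ne (frobNorm_nonneg X) h0.symm
  have h := le_sum_min_of_nets_unit A hs1 hs ht hup hlow ((frobNorm X)⁻¹ • X)
    ((rank_smul_le _ _).trans hX)
    (by rw [frobNorm_smul, abs_inv, abs_of_pos hp, inv_mul_cancel₀ h0])
  have h1 := mul_le_mul_of_nonneg_right h (sq_nonneg (frobNorm X))
  refine h1.trans (le_of_eq ?_)
  rw [Finset.sum_mul]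
  refine Finset.sum_congr rfl fun i _ => ?_
  rw [min_mul_of_nonneg _ _ (sq_nonneg _), frobInner_smul_right]
  congr 1
  field_simp

end Sampling


/-! ### The good event -/

/-- Chernoff's bound for a sum over an i.i.d. sample. -/
lemma chernoff {Ω 𝓩 : Type*} [MeasurableSpace Ω] [MeasurableSpace 𝓩] {P : Measure Ω}
    [IsProbabilityMeasure P] {ν : Measure 𝓩} {n : ℕ} {Z : Fin n → Ω → 𝓩}
    (hZ : ∀ i, HasLaw (Z i) ν P) (hind : iIndepFun Z P) {g : 𝓩 → ℝ} (hg : Measurable g) {b : ℝ}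
    (hb : ∫⁻ z, ENNReal.ofReal (Real.exp (g z)) ∂ν ≤ ENNReal.ofReal (Real.exp b)) (s : ℝ) :
    P {ω | s ≤ ∑ i, g (Z i ω)} ≤ ENNReal.ofReal (Real.exp (n * b - s)) := by
  have hm : ∀ i, AEMeasurable (Z i) P := fun i => (hZ i).aemeasurable
  -- `HasLaw` gives only almost-everywhere measurability, so the computation runs on measurable
  -- versions.
  let Y : Fin n → Ω → 𝓩 := fun i => (hm i).mk (Z i)
  have hY : ∀ i, Z i =ᵐ[P] Y i := fun i => (hm i).ae_eq_mk
  have hYm : ∀ i, Measurable (Y i) := fun i => (hm i).measurable_mk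
  have hf : Measurable fun z => ENNReal.ofReal (Real.exp (g z)) := by fun_prop
  have hall : ∀ᵐ ω ∂P, ∀ i, Z i ω = Y i ω := ae_all_iff.2 hY
  have hYind : iIndepFun Y P := hind.congr hY
  have h1 : ∫⁻ ω, ENNReal.ofReal (Real.exp (∑ i, g (Y i ω))) ∂P ≤
      ENNReal.ofReal (Real.exp (n * b)) := by
    have e : ∀ ω, ENNReal.ofReal (Real.exp (∑ i, g (Y i ω))) =
        ∏ i, ENNReal.ofReal (Real.exp (g (Y i ω))) := by
      intro ω
      rw [Real.exp_sum, ENNReal.ofReal_prod_of_nonneg fun i _ => (Real.exp_pos _).le]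
    simp_rw [e]
    rw [lintegral_prod_eq_prod_lintegral_of_indepFun Finset.univ
      (fun i ω => ENNReal.ofReal (Real.exp (g (Y i ω))))
      (hYind.comp (fun _ z => ENNReal.ofReal (Real.exp (g z))) fun _ => hf)
      fun i => hf.comp (hYm i)]
    have e2 : ∀ i, ∫⁻ ω, ENNReal.ofReal (Real.exp (g (Y i ω))) ∂P ≤
        ENNReal.ofReal (Real.exp b) := by
      intro i
      refine le_trans (le_of_eq ?_) hb
      rw [← (hZ i).map_eq, Measure.map_congr (hY i), lintegral_map hf (hYm i)]
    refine (Finset.prod_le_prod' fun i _ => e2 i).trans (le_of_eq ?_)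
    rw [Finset.prod_const, Finset.card_univ, Fintype.card_fin,
      ← ENNReal.ofReal_pow (Real.exp_pos _).le, ← Real.exp_nat_mul]
  have h2 : P {ω | s ≤ ∑ i, g (Z i ω)} ≤
      P {ω | ENNReal.ofReal (Real.exp s) ≤ ENNReal.ofReal (Real.exp (∑ i, g (Y i ω)))} := by
    refine measure_mono_ae ?_
    filter_upwards [hall] with ω hω hs
    have hs' : s ≤ ∑ i, g (Z i ω) := hs
    simp only [hω] at hs'
    exact ENNReal.ofReal_le_ofReal (Real.exp_le_exp.2 hs')
  have h3 := meas_ge_le_lintegral_div (μ := P)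
    (f := fun ω => ENNReal.ofReal (Real.exp (∑ i, g (Y i ω)))) (by fun_prop)
    (ε := ENNReal.ofReal (Real.exp s)) (by simp [Real.exp_pos]) ENNReal.ofReal_ne_top
  refine h2.trans (h3.trans ?_)
  rw [Real.exp_sub, ENNReal.ofReal_div_of_pos (Real.exp_pos s)]
  gcongr

/-- The factor spaces have dimensions `q d₁` and `q d₂`, and `1 + 2/ε = 201 ≤ exp (11/2)`. Netting
the factors is what makes the entropy proportional to `q * max d₁ d₂` instead of `d₁ d₂`. -/
lemma exists_factor_nets (d₁ d₂ q : ℕ) :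
    ∃ (s : Finset (EuclideanSpace ℝ (Fin q) →L[ℝ] EuclideanSpace ℝ (Fin d₁)))
      (t : Finset (Columns q d₂)), (∀ c ∈ s, ‖c‖ ≤ 1) ∧ (∀ c ∈ t, ‖c‖ ≤ 1) ∧
      (∀ x, ‖x‖ ≤ 1 → ∃ c ∈ s, ‖x - c‖ ≤ 1 / 100) ∧
      (∀ x, ‖x‖ ≤ 1 → ∃ c ∈ t, ‖x - c‖ ≤ 1 / 100) ∧
      ((s ×ˢ t).card : ℝ) ≤ Real.exp (11 * (q * (max d₁ d₂ : ℕ))) := by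
  obtain ⟨s, hs1, hsc, hs⟩ := exists_net
    (EuclideanSpace ℝ (Fin q) →L[ℝ] EuclideanSpace ℝ (Fin d₁)) (ε := 1 / 100) (by norm_num)
  obtain ⟨t, ht1, htc, ht⟩ := exists_net (Columns q d₂) (ε := 1 / 100) (by norm_num)
  refine ⟨s, t, hs1, ht1, hs, ht, ?_⟩
  have f1 : Module.finrank ℝ (EuclideanSpace ℝ (Fin q) →L[ℝ] EuclideanSpace ℝ (Fin d₁)) =
      q * d₁ := by
    rw [← (LinearMap.toContinuousLinearMap (𝕜 := ℝ) (E := EuclideanSpace ℝ (Fin q))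
      (F' := EuclideanSpace ℝ (Fin d₁))).finrank_eq, Module.finrank_linearMap]
    simp
  have f2 : Module.finrank ℝ (Columns q d₂) = d₂ * q := by
    rw [(WithLp.linearEquiv 2 ℝ (Fin d₂ → EuclideanSpace ℝ (Fin q))).finrank_eq,
      Module.finrank_pi_fintype]
    simp
  rw [f1] at hsc
  rw [f2] at htc
  rw [Finset.card_product]
  push_cast
  have h201 : (1 + 2 / (1 / 100) : ℝ) ≤ Real.exp (11 / 2) := by
    have h1 : (2.7 : ℝ) ≤ Real.exp 1 := by linarith [Real.exp_one_gt_d9]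
    have h2 : Real.exp (11 / 2) = Real.exp 1 ^ 5 * Real.exp (1 / 2) := by
      rw [← Real.exp_nat_mul, ← Real.exp_add]; norm_num
    have h3 : (2.7 : ℝ) ^ 5 ≤ Real.exp 1 ^ 5 := pow_le_pow_left₀ (by norm_num) h1 5
    have h4 : (1.5 : ℝ) ≤ Real.exp (1 / 2) := by
      linarith [Real.add_one_le_exp (1 / 2 : ℝ)]
    rw [h2]
    calc _ ≤ (2.7 : ℝ) ^ 5 * 1.5 := by norm_num
      _ ≤ _ := by gcongr
  calc (s.card : ℝ) * t.card
      ≤ Real.exp (11 / 2) ^ (q * d₁) * Real.exp (11 / 2) ^ (d₂ * q) := by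
        gcongr
        · exact hsc.trans (pow_le_pow_left₀ (by norm_num) h201 _)
        · exact htc.trans (pow_le_pow_left₀ (by norm_num) h201 _)
    _ = Real.exp (11 / 2 * (q * d₁ + q * d₂)) := by
        rw [← Real.exp_nat_mul, ← Real.exp_nat_mul, ← Real.exp_add]
        congr 1; push_cast; ring
    _ ≤ _ := by
        refine Real.exp_le_exp.2 ?_
        have h1 : (d₁ : ℝ) ≤ max (d₁ : ℝ) d₂ := le_max_left _ _
        have h2 : (d₂ : ℝ) ≤ max (d₁ : ℝ) d₂ := le_max_right _ _
        have hq : (0 : ℝ) ≤ q := Nat.cast_nonneg q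
        nlinarith

section Sample

variable {Ω : Type*} [MeasurableSpace Ω] {P : Measure Ω} [IsProbabilityMeasure P] {M : Model}
  {d₁ d₂ n : ℕ} {Xnat : Matrix (Fin d₁) (Fin d₂) ℝ} {A : Fin n → Ω → Matrix (Fin d₁) (Fin d₂) ℝ}
  {y : Fin n → Ω → ℝ}

lemma measure_sum_sq_ge (hlaw : ∀ i, HasLaw (fun ω => (A i ω, y i ω)) (observationLaw M Xnat) P)
    (hind : iIndepFun (fun i ω => (A i ω, y i ω)) P) (X : Matrix (Fin d₁) (Fin d₂) ℝ)
    (hX : frobNorm X ≤ 1) :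
    P {ω | 1.6 * n < ∑ i, frobInner (A i ω) X ^ 2} ≤ ENNReal.ofReal (Real.exp (-(n / 100))) := by
  have hm' := ((measurable_frobInner_left X).comp measurable_fst :
    Measurable fun z : Matrix (Fin d₁) (Fin d₂) ℝ × ℝ => frobInner z.1 X)
  have h := chernoff hlaw hind (g := fun z => 1 / 8 * frobInner z.1 X ^ 2) (by fun_prop)
    (lintegral_exp_sq_le M Xnat X hX) (1 / 8 * (1.6 * n))
  refine (measure_mono fun ω hω => ?_).trans (h.trans (ENNReal.ofReal_le_ofReal
    (Real.exp_le_exp.2 ?_)))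
  · simp only [Set.mem_ofPred_eq, ← Finset.mul_sum] at hω ⊢
    linarith
  · have : (0 : ℝ) ≤ n := Nat.cast_nonneg n
    linarith

lemma measure_sum_min_le (hlaw : ∀ i, HasLaw (fun ω => (A i ω, y i ω)) (observationLaw M Xnat) P)
    (hind : iIndepFun (fun i ω => (A i ω, y i ω)) P) (X : Matrix (Fin d₁) (Fin d₂) ℝ)
    (hX : frobNorm X = 1) :
    P {ω | ∑ i, min (frobInner (A i ω) X ^ 2) 25 < 0.7225 * n} ≤
      ENNReal.ofReal (Real.exp (-(n / 100))) := by
  have hm' := ((measurable_frobInner_left X).comp measurable_fst :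
    Measurable fun z : Matrix (Fin d₁) (Fin d₂) ℝ × ℝ => frobInner z.1 X)
  have h := chernoff hlaw hind (g := fun z => -(3 / 10) * min (frobInner z.1 X ^ 2) 25)
    (by fun_prop) (lintegral_exp_neg_min_sq_le M Xnat X hX) (-(3 / 10) * (0.7225 * n))
  refine (measure_mono fun ω hω => ?_).trans (h.trans (ENNReal.ofReal_le_ofReal
    (Real.exp_le_exp.2 ?_)))
  · simp only [Set.mem_ofPred_eq, ← Finset.mul_sum] at hω ⊢
    linarith
  · have : (0 : ℝ) ≤ n := Nat.cast_nonneg n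
    linarith

lemma measure_sum_noise_ge
    (hlaw : ∀ i, HasLaw (fun ω => (A i ω, y i ω)) (observationLaw M Xnat) P)
    (hind : iIndepFun (fun i ω => (A i ω, y i ω)) P) (X : Matrix (Fin d₁) (Fin d₂) ℝ)
    (hX : frobNorm X ≤ 1) (hn : 0 < n) {u : ℝ} (hu : 0 ≤ u) (hun : 40 * u ≤ n) :
    P {ω | √(80 * M.noise * n * u) <
        ∑ i, (y i ω - M.mean (frobInner (A i ω) Xnat)) * frobInner (A i ω) X} ≤
      ENNReal.ofReal (Real.exp (-(20 * u))) := by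
  have hn' : (0 : ℝ) < n := Nat.cast_pos.2 hn
  have hm := (M.measurable_mean.comp ((measurable_frobInner_left Xnat).comp measurable_fst) :
    Measurable fun z : Matrix (Fin d₁) (Fin d₂) ℝ × ℝ => M.mean (frobInner z.1 Xnat))
  have hm' := ((measurable_frobInner_left X).comp measurable_fst :
    Measurable fun z : Matrix (Fin d₁) (Fin d₂) ℝ × ℝ => frobInner z.1 X)
  have key : ∀ s : ℝ, s ^ 2 * M.noise ≤ 1 / 2 → 0 ≤ s → ∀ v : ℝ,
      P {ω | v ≤ ∑ i, (y i ω - M.mean (frobInner (A i ω) Xnat)) * frobInner (A i ω) X} ≤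
        ENNReal.ofReal (Real.exp (n * (s ^ 2 * M.noise) - s * v)) := by
    intro s hs hs0 v
    have h := chernoff hlaw hind
      (g := fun z => s * ((z.2 - M.mean (frobInner z.1 Xnat)) * frobInner z.1 X))
      (by fun_prop) (lintegral_exp_noise_le M Xnat X hX hs) (s * v)
    refine (measure_mono fun ω hω => ?_).trans h
    simp only [Set.mem_ofPred_eq, ← Finset.mul_sum] at hω ⊢
    exact mul_le_mul_of_nonneg_left hω hs0
  -- Without noise every `s` is admissible, and letting `s → ∞` shows that each positive level is
  -- exceeded with probability zero.
  rcases M.noise_nonneg.eq_or_lt with h0 | hc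
  · rw [← h0]
    simp only [mul_zero, zero_mul, Real.sqrt_zero]
    refine le_trans (le_of_eq ?_) zero_le
    have hsub : {ω | 0 < ∑ i, (y i ω - M.mean (frobInner (A i ω) Xnat)) * frobInner (A i ω) X} ⊆
        ⋃ k : ℕ, {ω | 1 / ((k : ℝ) + 1) ≤
          ∑ i, (y i ω - M.mean (frobInner (A i ω) Xnat)) * frobInner (A i ω) X} := by
      intro ω hω
      obtain ⟨k, hk⟩ := exists_nat_one_div_lt (Set.mem_ofPred_eq ▸ hω)
      exact Set.mem_iUnion.2 ⟨k, hk.le⟩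
    refine measure_mono_null hsub (measure_iUnion_null fun k => ?_)
    refine le_antisymm ?_ zero_le
    have hk : (0 : ℝ) < 1 / ((k : ℝ) + 1) := by positivity
    have ht : Filter.Tendsto (fun s : ℝ => ENNReal.ofReal (Real.exp (-(s * (1 / ((k : ℝ) + 1))))))
        Filter.atTop (nhds 0) := by
      rw [← ENNReal.ofReal_zero]
      exact ENNReal.tendsto_ofReal (Real.tendsto_exp_neg_atTop_nhds_zero.comp
        (Filter.tendsto_id.atTop_mul_const hk))
    refine ge_of_tendsto ht (Filter.eventually_atTop.2 ⟨0, fun s hs => ?_⟩)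
    refine (key s (by rw [← h0]; norm_num) hs _).trans (le_of_eq ?_)
    rw [← h0]; congr 2; ring
  · set v := √(80 * M.noise * n * u) with hv
    have hv2 : v ^ 2 = 80 * M.noise * n * u := Real.sq_sqrt (by positivity)
    -- `s = v / (2 n c(σ))` minimizes the Chernoff exponent, with value `-v² / (4 n c(σ)) = -20 u`;
    -- its admissibility is exactly `40 u ≤ n`.
    refine (measure_mono fun ω (hω : v < _) => hω.le).trans
      ((key (v / (2 * n * M.noise)) ?_ (by positivity) v).trans
        (ENNReal.ofReal_le_ofReal (Real.exp_le_exp.2 ?_)))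
    · rw [div_pow, hv2]
      field_simp
      linarith
    · have e : (n : ℝ) * ((v / (2 * n * M.noise)) ^ 2 * M.noise) - v / (2 * n * M.noise) * v =
          -(v ^ 2 / (4 * n * M.noise)) := by
        field_simp; ring
      rw [e, hv2]
      refine le_of_eq ?_
      field_simp
      ring

/-- With high probability, the sample behaves well on all matrices of rank at most `q`. -/
theorem exists_good_event
    (hlaw : ∀ i, HasLaw (fun ω => (A i ω, y i ω)) (observationLaw M Xnat) P)
    (hind : iIndepFun (fun i ω => (A i ω, y i ω)) P) {q : ℕ} (hq : 1 ≤ q) (hd : 1 ≤ max d₁ d₂)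
    (hn : 1500 * ((q : ℝ) * (max d₁ d₂ : ℕ)) ≤ n) :
    ∃ E : Set Ω, MeasurableSet E ∧
      ENNReal.ofReal (1 - Real.exp (-((max d₁ d₂ : ℕ) : ℝ))) ≤ P E ∧
      ∀ ω ∈ E, ∀ X : Matrix (Fin d₁) (Fin d₂) ℝ, X.rank ≤ q →
        ∑ i, frobInner (A i ω) X ^ 2 ≤ 17 / 8 * n * frobNorm X ^ 2 ∧
        16 / 25 * (n : ℝ) * frobNorm X ^ 2 ≤
          ∑ i, min (frobInner (A i ω) X ^ 2) (25 * frobNorm X ^ 2) ∧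
        |∑ i, (y i ω - M.mean (frobInner (A i ω) Xnat)) * frobInner (A i ω) X| ≤
          10 * √(M.noise * n * (q * (max d₁ d₂ : ℕ))) * frobNorm X := by
  set d : ℕ := max d₁ d₂ with hd'
  set u : ℝ := (q : ℝ) * d with hu
  have hd1 : (1 : ℝ) ≤ d := by exact_mod_cast hd
  have hq1 : (1 : ℝ) ≤ q := by exact_mod_cast hq
  have hud : (d : ℝ) ≤ u := by rw [hu]; nlinarith
  have hn0 : 0 < n := by
    have : (0 : ℝ) < n := by linarith
    exact_mod_cast this
  obtain ⟨s, t, hs1, ht1, hs, ht, hcard⟩ := exists_factor_nets d₁ d₂ q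
  -- The bad set of a net pair. The noise event appears for `X` and `-X` because the Chernoff bound
  -- is one-sided.
  let B : (EuclideanSpace ℝ (Fin q) →L[ℝ] EuclideanSpace ℝ (Fin d₁)) × Columns q d₂ → Set Ω :=
    fun z =>
      ({ω | 1.6 * n < ∑ i, frobInner (A i ω) (factorProd d₁ d₂ q z.1 z.2) ^ 2} ∪
      {ω | frobNorm (factorProd d₁ d₂ q z.1 z.2) ≠ 0 ∧
        ∑ i, min (frobInner (A i ω) ((frobNorm (factorProd d₁ d₂ q z.1 z.2))⁻¹ •
          factorProd d₁ d₂ q z.1 z.2) ^ 2) 25 < 0.7225 * n}) ∪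
      ({ω | √(80 * M.noise * n * u) < ∑ i, (y i ω - M.mean (frobInner (A i ω) Xnat)) *
        frobInner (A i ω) (factorProd d₁ d₂ q z.1 z.2)} ∪
      {ω | √(80 * M.noise * n * u) < ∑ i, (y i ω - M.mean (frobInner (A i ω) Xnat)) *
        frobInner (A i ω) ((-1 : ℝ) • factorProd d₁ d₂ q z.1 z.2)})
  have hB : ∀ z ∈ s ×ˢ t, P (B z) ≤ ENNReal.ofReal (4 * Real.exp (-(14 * u))) := by
    intro z hz
    rw [Finset.mem_product] at hz
    have hX : frobNorm (factorProd d₁ d₂ q z.1 z.2) ≤ 1 :=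
      (frobNorm_factorProd_le _ _).trans
        (mul_le_one₀ (hs1 _ hz.1) (norm_nonneg _) (ht1 _ hz.2))
    have hexp : ENNReal.ofReal (Real.exp (-(n / 100))) ≤ ENNReal.ofReal (Real.exp (-(14 * u))) :=
      ENNReal.ofReal_le_ofReal (Real.exp_le_exp.2 (by linarith))
    have hexp' : ENNReal.ofReal (Real.exp (-(20 * u))) ≤ ENNReal.ofReal (Real.exp (-(14 * u))) :=
      ENNReal.ofReal_le_ofReal (Real.exp_le_exp.2 (by linarith))
    have h1 := (measure_sum_sq_ge hlaw hind _ hX).trans hexp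
    have h2 : P {ω | frobNorm (factorProd d₁ d₂ q z.1 z.2) ≠ 0 ∧
        ∑ i, min (frobInner (A i ω) ((frobNorm (factorProd d₁ d₂ q z.1 z.2))⁻¹ •
          factorProd d₁ d₂ q z.1 z.2) ^ 2) 25 < 0.7225 * n} ≤
        ENNReal.ofReal (Real.exp (-(14 * u))) := by
      by_cases h0 : frobNorm (factorProd d₁ d₂ q z.1 z.2) = 0
      · simp [h0]
      · refine (measure_mono fun ω hω => hω.2).trans ((measure_sum_min_le hlaw hind _ ?_).trans hexp)
        rw [frobNorm_smul, abs_inv, abs_of_nonneg (frobNorm_nonneg _), inv_mul_cancel₀ h0]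
    have h3 := (measure_sum_noise_ge hlaw hind _ hX hn0 (u := u) (by linarith)
      (by linarith)).trans hexp'
    have h4 := (measure_sum_noise_ge hlaw hind ((-1 : ℝ) • factorProd d₁ d₂ q z.1 z.2)
      (by rw [frobNorm_smul]; simpa using hX) hn0 (u := u) (by linarith)
      (by linarith)).trans hexp'
    refine (measure_union_le _ _).trans ((add_le_add (measure_union_le _ _)
      (measure_union_le _ _)).trans ((add_le_add (add_le_add h1 h2) (add_le_add h3 h4)).trans
        (le_of_eq ?_)))
    rw [← ENNReal.ofReal_add (by positivity) (by positivity),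
      ← ENNReal.ofReal_add (by positivity) (by positivity)]
    congr 1; ring
  have hbad : P (⋃ z ∈ s ×ˢ t, B z) ≤ ENNReal.ofReal (Real.exp (-(d : ℝ))) := by
    refine (measure_biUnion_finset_le _ _).trans ((Finset.sum_le_sum hB).trans ?_)
    rw [Finset.sum_const, nsmul_eq_mul, ← ENNReal.ofReal_natCast,
      ← ENNReal.ofReal_mul (Nat.cast_nonneg _)]
    refine ENNReal.ofReal_le_ofReal ?_
    -- Union bound: `exp (11 u)` pairs, four events each, `exp (-14 u)` per event; this absorbs the
    -- 4 and leaves `exp (-u)`.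
    have h4 : (4 : ℝ) ≤ Real.exp (2 * u) := by
      have h1 := Real.quadratic_le_exp_of_nonneg (x := 2 * u) (by linarith)
      nlinarith
    calc _ ≤ Real.exp (11 * u) * (Real.exp (2 * u) * Real.exp (-(14 * u))) := by gcongr
      _ = Real.exp (-u) := by rw [← Real.exp_add, ← Real.exp_add]; congr 1; ring
      _ ≤ _ := Real.exp_le_exp.2 (by linarith)
  refine ⟨(toMeasurable P (⋃ z ∈ s ×ˢ t, B z))ᶜ, (measurableSet_toMeasurable _ _).compl, ?_, ?_⟩
  · rw [prob_compl_eq_one_sub (measurableSet_toMeasurable _ _), measure_toMeasurable,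
      ENNReal.ofReal_sub _ (Real.exp_pos _).le, ENNReal.ofReal_one]
    exact tsub_le_tsub_left hbad 1
  · intro ω hω X hX
    have hω' : ∀ z ∈ s ×ˢ t, ω ∉ B z := by
      intro z hz hzω
      exact hω (subset_toMeasurable _ _ (Set.mem_biUnion hz hzω))
    have hgood : ∀ U ∈ s, ∀ W ∈ t,
        ∑ i, frobInner (A i ω) (factorProd d₁ d₂ q U W) ^ 2 ≤ 1.6 * n ∧
        (frobNorm (factorProd d₁ d₂ q U W) ≠ 0 → 0.7225 * n ≤ ∑ i, min (frobInner (A i ω)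
          ((frobNorm (factorProd d₁ d₂ q U W))⁻¹ • factorProd d₁ d₂ q U W) ^ 2) 25) ∧
        ∑ i, (y i ω - M.mean (frobInner (A i ω) Xnat)) *
          frobInner (A i ω) (factorProd d₁ d₂ q U W) ≤ √(80 * M.noise * n * u) ∧
        ∑ i, (y i ω - M.mean (frobInner (A i ω) Xnat)) *
          frobInner (A i ω) ((-1 : ℝ) • factorProd d₁ d₂ q U W) ≤ √(80 * M.noise * n * u) := by
      intro U hU W hW
      have h := hω' (U, W) (Finset.mem_product.2 ⟨hU, hW⟩)
      simp only [B, Set.mem_union, Set.mem_ofPred_eq, not_or, not_lt, not_and] at h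
      exact ⟨h.1.1, h.1.2, h.2.1, h.2.2⟩
    have hup : ∀ U ∈ s, ∀ W ∈ t, ‖sampling (fun i => A i ω) (factorProd d₁ d₂ q U W)‖ ≤
        √(1.6 * n) := by
      intro U hU W hW
      refine Real.le_sqrt_of_sq_le ?_
      rw [norm_sampling_sq]
      exact (hgood U hU W hW).1
    refine ⟨?_, ?_, ?_⟩
    · have h := norm_le_of_nets (sampling fun i => A i ω) hs1 hs ht (Real.sqrt_nonneg _) hup X hX
      have h2 := pow_le_pow_left₀ (norm_nonneg _) h 2
      rw [norm_sampling_sq, mul_pow, div_pow, Real.sq_sqrt (by positivity)] at h2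
      refine h2.trans ?_
      refine mul_le_mul_of_nonneg_right ?_ (sq_nonneg _)
      rw [div_le_iff₀ (by norm_num)]
      linarith
    · exact le_sum_min_of_nets (fun i => A i ω) hs1 hs ht hup
        (fun U hU W hW => (hgood U hU W hW).2.1) X hX
    · have h := norm_le_of_nets (weightedSampling (fun i => A i ω)
        fun i => y i ω - M.mean (frobInner (A i ω) Xnat)) hs1 hs ht
        (Real.sqrt_nonneg (80 * M.noise * n * u)) (fun U hU W hW => ?_) X hX
      · have e : √(80 * M.noise * n * u) ≤ 9 * √(M.noise * n * u) := by
          rw [mul_assoc, mul_assoc, Real.sqrt_mul (by norm_num), ← mul_assoc]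
          gcongr
          exact Real.sqrt_le_iff.2 (by norm_num)
        refine (le_of_eq rfl).trans (h.trans ?_)
        refine mul_le_mul_of_nonneg_right ?_ (frobNorm_nonneg X)
        rw [div_le_iff₀ (by norm_num)]
        nlinarith [Real.sqrt_nonneg (M.noise * n * u)]
      · have h1 := (hgood U hU W hW).2.2.1
        have h2 := (hgood U hU W hW).2.2.2
        refine abs_le.2 ⟨?_, h1⟩
        have e : ∑ i, (y i ω - M.mean (frobInner (A i ω) Xnat)) *
            frobInner (A i ω) ((-1 : ℝ) • factorProd d₁ d₂ q U W) =
            -(weightedSampling (fun i => A i ω)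
              (fun i => y i ω - M.mean (frobInner (A i ω) Xnat)) (factorProd d₁ d₂ q U W)) := by
          simp only [frobInner_smul_right, weightedSampling, LinearMap.coe_mk, AddHom.coe_mk]
          simp
        linarith

end Sample


/-! ### The log partition function -/

/-- The second derivative of `ψ`. -/
noncomputable def Model.curvature : Model → ℝ → ℝ
  | .matrixSensing _ => fun _ => 1
  | .oneBit => fun θ => Real.sigmoid θ * (1 - Real.sigmoid θ)

lemma Model.hasDerivAt_psi (M : Model) (θ : ℝ) : HasDerivAt M.psi (M.mean θ) θ := by
  cases M with
  | matrixSensing σ =>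
    have := ((hasDerivAt_id θ).pow 2).const_mul (1 / 2)
    refine this.congr_deriv ?_
    simp [Model.mean]
  | oneBit =>
    have h := ((Real.hasDerivAt_exp θ).const_add 1).log (by positivity)
    refine h.congr_deriv ?_
    simp only [Model.mean, Real.sigmoid_def, Real.exp_neg]
    have := Real.exp_pos θ
    field_simp
    ring

lemma Model.hasDerivAt_mean (M : Model) (θ : ℝ) : HasDerivAt M.mean (M.curvature θ) θ := by
  cases M with
  | matrixSensing σ => exact hasDerivAt_id θ
  | oneBit => exact Real.hasDerivAt_sigmoid θ

lemma Model.iteratedDeriv_two_psi (M : Model) : iteratedDeriv 2 M.psi = M.curvature := by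
  rw [iteratedDeriv_succ, iteratedDeriv_one, funext fun θ => (M.hasDerivAt_psi θ).deriv]
  exact funext fun θ => (M.hasDerivAt_mean θ).deriv

lemma Model.curvature_pos (M : Model) (θ : ℝ) : 0 < M.curvature θ := by
  cases M with
  | matrixSensing σ => exact one_pos
  | oneBit => exact mul_pos (Real.sigmoid_pos θ) (sub_pos.2 (Real.sigmoid_lt_one θ))

lemma Model.curvature_le_one (M : Model) (θ : ℝ) : M.curvature θ ≤ 1 := by
  cases M with
  | matrixSensing σ => exact le_rfl
  | oneBit =>
    have := Real.sigmoid_pos θ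
    have := Real.sigmoid_lt_one θ
    simp only [Model.curvature]
    nlinarith

lemma Model.continuous_curvature (M : Model) : Continuous M.curvature := by
  cases M with
  | matrixSensing σ => exact continuous_const
  | oneBit => exact continuous_sigmoid.mul (continuous_const.sub continuous_sigmoid)

lemma Model.curvature_le_Bsup (M : Model) (θ : ℝ) : M.curvature θ ≤ M.Bsup := by
  rw [Model.Bsup, M.iteratedDeriv_two_psi]
  refine (le_abs_self _).trans (le_ciSup (f := fun x => |M.curvature x|) ⟨1, ?_⟩ θ)
  rintro _ ⟨x, rfl⟩
  simp only [abs_of_pos (M.curvature_pos x)]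
  exact M.curvature_le_one x

lemma Model.quarter_le_Bsup (M : Model) : 1 / 4 ≤ M.Bsup := by
  refine le_trans ?_ (M.curvature_le_Bsup 0)
  cases M with
  | matrixSensing σ => simp only [Model.curvature]; norm_num
  | oneBit => simp only [Model.curvature, Real.sigmoid_zero]; norm_num

lemma Model.Binf_le_curvature (M : Model) {R x : ℝ} (hx : |x| ≤ R) :
    M.Binf R ≤ M.curvature x := by
  rw [Model.Binf, M.iteratedDeriv_two_psi]
  refine csInf_le ⟨0, ?_⟩ ⟨x, hx, rfl⟩
  rintro _ ⟨x, -, rfl⟩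
  exact (M.curvature_pos x).le

lemma Model.Binf_pos (M : Model) {R : ℝ} (hR : 0 ≤ R) : 0 < M.Binf R := by
  rw [Model.Binf, M.iteratedDeriv_two_psi]
  have hc : IsCompact {x : ℝ | |x| ≤ R} := by
    have : {x : ℝ | |x| ≤ R} = Set.Icc (-R) R := by
      ext x; simp [abs_le]
    rw [this]; exact isCompact_Icc
  obtain ⟨x, -, hx⟩ := (hc.image M.continuous_curvature).sInf_mem ⟨_, 0, by simpa using hR, rfl⟩
  rw [← hx]
  exact M.curvature_pos x

lemma Model.Binf_le_Bsup (M : Model) {R : ℝ} (hR : 0 ≤ R) : M.Binf R ≤ M.Bsup :=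
  (M.Binf_le_curvature (x := 0) (by simpa using hR)).trans (M.curvature_le_Bsup 0)

/-- Subtract the quadratic from the Taylor remainder along the segment and apply the mean value
theorem twice; no continuity of `f''` is used. -/
lemma taylor_two_ge {f f' f'' : ℝ → ℝ} (hf : ∀ x, HasDerivAt f (f' x) x)
    (hf' : ∀ x, HasDerivAt f' (f'' x) x) {a b m : ℝ}
    (hm : ∀ t ∈ Set.Icc (0 : ℝ) 1, m ≤ f'' (a + t * (b - a))) :
    m / 2 * (b - a) ^ 2 ≤ f b - f a - f' a * (b - a) := by
  have hl : ∀ t : ℝ, HasDerivAt (fun t => a + t * (b - a)) (b - a) t := fun t => by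
    simpa using ((hasDerivAt_id t).mul_const (b - a)).const_add a
  let φ : ℝ → ℝ := fun t => f (a + t * (b - a)) - f' a * (b - a) * t - m / 2 * (b - a) ^ 2 * t ^ 2
  let φ' : ℝ → ℝ := fun t => f' (a + t * (b - a)) * (b - a) - f' a * (b - a) - m * (b - a) ^ 2 * t
  let φ'' : ℝ → ℝ := fun t => f'' (a + t * (b - a)) * (b - a) * (b - a) - m * (b - a) ^ 2
  have h1 : ∀ t, HasDerivAt φ (φ' t) t := fun t => by
    have e1 := (hf (a + t * (b - a))).comp t (hl t)
    have e2 := (hasDerivAt_id t).const_mul (f' a * (b - a))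
    have e3 := ((hasDerivAt_id t).pow 2).const_mul (m / 2 * (b - a) ^ 2)
    refine ((e1.sub e2).sub e3).congr_deriv ?_
    simp only [φ', id]
    norm_num
    ring
  have h2 : ∀ t, HasDerivAt φ' (φ'' t) t := fun t => by
    have e1 := ((hf' (a + t * (b - a))).comp t (hl t)).mul_const (b - a)
    have e3 := (hasDerivAt_id t).const_mul (m * (b - a) ^ 2)
    refine ((e1.sub_const (f' a * (b - a))).sub e3).congr_deriv ?_
    simp only [φ'']
    ring
  obtain ⟨c, hc, hφ⟩ := exists_hasDerivAt_eq_slope φ φ' (zero_lt_one' ℝ)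
    (fun t _ => (h1 t).continuousAt.continuousWithinAt) fun t _ => h1 t
  obtain ⟨c', hc', hφ'⟩ := exists_hasDerivAt_eq_slope φ' φ'' hc.1
    (fun t _ => (h2 t).continuousAt.continuousWithinAt) fun t _ => h2 t
  have h3 : 0 ≤ φ'' c' := by
    have := hm c' ⟨hc'.1.le, (hc'.2.trans hc.2).le⟩
    simp only [φ'']
    nlinarith [sq_nonneg (b - a)]
  have h4 : φ' 0 = 0 := by simp [φ']
  rw [h4, sub_zero, sub_zero] at hφ'
  have h5 : 0 ≤ φ' c := by
    rw [hφ'] at h3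
    by_contra! hcon
    exact absurd h3 (not_le.2 (div_neg_of_neg_of_pos hcon hc.1))
  rw [hφ] at h5
  simp only [φ] at h5
  norm_num at h5
  linarith

lemma Model.psi_bregman_le (M : Model) (a b : ℝ) :
    M.psi b - M.psi a - M.mean a * (b - a) ≤ M.Bsup / 2 * (b - a) ^ 2 := by
  have h := taylor_two_ge (f := fun x => -M.psi x) (f' := fun x => -M.mean x)
    (f'' := fun x => -M.curvature x) (fun x => (M.hasDerivAt_psi x).neg)
    (fun x => (M.hasDerivAt_mean x).neg) (a := a) (b := b) (m := -M.Bsup)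
    fun t _ => neg_le_neg (M.curvature_le_Bsup _)
  linarith

lemma Model.psi_bregman_nonneg (M : Model) (a b : ℝ) :
    0 ≤ M.psi b - M.psi a - M.mean a * (b - a) := by
  have h := taylor_two_ge M.hasDerivAt_psi M.hasDerivAt_mean (a := a) (b := b) (m := 0)
    fun t _ => (M.curvature_pos _).le
  linarith

lemma Model.le_psi_bregman (M : Model) {R a b : ℝ} (ha : |a| ≤ R) (hb : |b| ≤ R) :
    M.Binf R / 2 * (b - a) ^ 2 ≤ M.psi b - M.psi a - M.mean a * (b - a) := by
  refine taylor_two_ge M.hasDerivAt_psi M.hasDerivAt_mean fun t ht => M.Binf_le_curvature ?_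
  rw [abs_le] at ha hb ⊢
  obtain ⟨h0, h1⟩ := ht
  constructor <;> nlinarith

/-! ### The loss -/

section Loss

variable {d₁ d₂ n : ℕ}

lemma hasDerivAt_loss_line (M : Model) (A : Fin n → Matrix (Fin d₁) (Fin d₂) ℝ) (y : Fin n → ℝ)
    (X D : Matrix (Fin d₁) (Fin d₂) ℝ) :
    HasDerivAt (fun t : ℝ => loss M A y (X + t • D))
      (1 / (n : ℝ) * ∑ k, (M.mean (frobInner (A k) X) - y k) * frobInner (A k) D) 0 := by
  unfold loss
  refine HasDerivAt.const_mul _ (HasDerivAt.fun_sum fun k _ => ?_)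
  have e : (fun t : ℝ => M.psi (frobInner (X + t • D) (A k)) - y k * frobInner (A k) (X + t • D)) =
      fun t : ℝ => M.psi (frobInner (A k) X + t * frobInner (A k) D) -
        y k * (frobInner (A k) X + t * frobInner (A k) D) := by
    funext t
    rw [frobInner_comm (X + t • D), frobInner_add_right, frobInner_smul_right]
  rw [e]
  have hl : HasDerivAt (fun t : ℝ => frobInner (A k) X + t * frobInner (A k) D)
      (frobInner (A k) D) 0 := by
    simpa using ((hasDerivAt_id (0 : ℝ)).mul_const (frobInner (A k) D)).const_add
      (frobInner (A k) X)
  have h1 := (M.hasDerivAt_psi (frobInner (A k) X + 0 * frobInner (A k) D)).comp (0 : ℝ) hl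
  refine (h1.sub (hl.const_mul (y k))).congr_deriv ?_
  rw [zero_mul, add_zero]
  ring

lemma matGradient_loss (M : Model) (A : Fin n → Matrix (Fin d₁) (Fin d₂) ℝ) (y : Fin n → ℝ)
    (X : Matrix (Fin d₁) (Fin d₂) ℝ) (i : Fin d₁) (j : Fin d₂) :
    matGradient (loss M A y) X i j =
      1 / (n : ℝ) * ∑ k, (M.mean (frobInner (A k) X) - y k) * A k i j := by
  have h := (hasDerivAt_loss_line M A y X (Matrix.single i j 1)).deriv
  simp only [matGradient, Matrix.of_apply, lineDeriv]
  rw [h]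
  congr 1
  refine Finset.sum_congr rfl fun k _ => ?_
  congr 1
  simp [frobInner, Matrix.single_apply, ite_and]

lemma frobInner_matGradient_loss (M : Model) (A : Fin n → Matrix (Fin d₁) (Fin d₂) ℝ)
    (y : Fin n → ℝ) (X D : Matrix (Fin d₁) (Fin d₂) ℝ) :
    frobInner (matGradient (loss M A y) X) D =
      1 / (n : ℝ) * ∑ k, (M.mean (frobInner (A k) X) - y k) * frobInner (A k) D := by
  simp only [frobInner, matGradient_loss M A y X]
  simp only [Finset.mul_sum, Finset.sum_mul]
  rw [Finset.sum_congr rfl fun i _ => Finset.sum_comm, Finset.sum_comm]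
  refine Finset.sum_congr rfl fun k _ => Finset.sum_congr rfl fun i _ =>
    Finset.sum_congr rfl fun j _ => ?_
  ring

/-- The responses enter the loss linearly and cancel, so its curvature depends on the measurements
alone. -/
lemma loss_bregman (M : Model) (A : Fin n → Matrix (Fin d₁) (Fin d₂) ℝ) (y : Fin n → ℝ)
    (X Y : Matrix (Fin d₁) (Fin d₂) ℝ) :
    loss M A y Y - loss M A y X - frobInner (matGradient (loss M A y) X) (Y - X) =
      1 / (n : ℝ) * ∑ k, (M.psi (frobInner (A k) Y) - M.psi (frobInner (A k) X) -
        M.mean (frobInner (A k) X) * (frobInner (A k) Y - frobInner (A k) X)) := by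
  rw [frobInner_matGradient_loss]
  unfold loss
  rw [← mul_sub, ← mul_sub, ← Finset.sum_sub_distrib, ← Finset.sum_sub_distrib]
  congr 1
  refine Finset.sum_congr rfl fun k _ => ?_
  rw [frobInner_comm Y, frobInner_comm X, frobInner_sub_right]
  ring

/-- Restricted smoothness. -/
lemma loss_bregman_le (M : Model) (hn : 0 < n) (A : Fin n → Matrix (Fin d₁) (Fin d₂) ℝ)
    (y : Fin n → ℝ) (X Y : Matrix (Fin d₁) (Fin d₂) ℝ)
    (h : ∑ k, frobInner (A k) (Y - X) ^ 2 ≤ 17 / 8 * n * frobNorm (Y - X) ^ 2) :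
    loss M A y Y - loss M A y X - frobInner (matGradient (loss M A y) X) (Y - X) ≤
      17 / 16 * M.Bsup * frobNorm (Y - X) ^ 2 := by
  have hn' : (0 : ℝ) < n := Nat.cast_pos.2 hn
  rw [loss_bregman, one_div, inv_mul_le_iff₀ hn']
  calc _ ≤ ∑ k, M.Bsup / 2 * frobInner (A k) (Y - X) ^ 2 := by
        refine Finset.sum_le_sum fun k _ => ?_
        rw [frobInner_sub_right]
        exact M.psi_bregman_le _ _
    _ ≤ M.Bsup / 2 * (17 / 8 * n * frobNorm (Y - X) ^ 2) := by
        rw [← Finset.mul_sum]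
        refine mul_le_mul_of_nonneg_left h ?_
        linarith [M.quarter_le_Bsup]
    _ = _ := by ring

/-- Restricted strong convexity. -/
lemma le_loss_bregman (M : Model) (hn : 0 < n) (A : Fin n → Matrix (Fin d₁) (Fin d₂) ℝ)
    (y : Fin n → ℝ) {ξ : ℝ} (hξ : 0 < ξ) (X Y : Matrix (Fin d₁) (Fin d₂) ℝ)
    (hX : frobNorm X ≤ ξ) (hY : frobNorm Y ≤ ξ)
    (hX1 : ∑ k, frobInner (A k) X ^ 2 ≤ 17 / 8 * n * frobNorm X ^ 2)
    (hY1 : ∑ k, frobInner (A k) Y ^ 2 ≤ 17 / 8 * n * frobNorm Y ^ 2)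
    (h : 16 / 25 * (n : ℝ) * frobNorm (Y - X) ^ 2 ≤
      ∑ k, min (frobInner (A k) (Y - X) ^ 2) (25 * frobNorm (Y - X) ^ 2)) :
    3 / 10 * M.Binf (100 * ξ) * frobNorm (Y - X) ^ 2 ≤
      loss M A y Y - loss M A y X - frobInner (matGradient (loss M A y) X) (Y - X) := by
  have hn' : (0 : ℝ) < n := Nat.cast_pos.2 hn
  have hB := M.Binf_pos (R := 100 * ξ) (by positivity)
  set B := M.Binf (100 * ξ) with hBdef
  set δ := frobNorm (Y - X) ^ 2 with hδ
  have hδ0 : 0 ≤ δ := sq_nonneg _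
  rw [loss_bregman, one_div, le_inv_mul_iff₀ hn']
  -- If both measurements stay within `100 ξ`, this is the curvature bound. Otherwise the subtracted
  -- term is at least `25 δ`, the left side is nonpositive, and convexity suffices. On average the
  -- subtracted term is at most `25 * (17/4) / 10000 * δ`, well below the `(16/25 - 3/5) δ` to
  -- spare.
  have hpt : ∀ k, B / 2 * (min (frobInner (A k) (Y - X) ^ 2) (25 * δ) -
      25 * δ * ((frobInner (A k) X ^ 2 + frobInner (A k) Y ^ 2) / (100 * ξ) ^ 2)) ≤
      M.psi (frobInner (A k) Y) - M.psi (frobInner (A k) X) -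
        M.mean (frobInner (A k) X) * (frobInner (A k) Y - frobInner (A k) X) := by
    intro k
    rw [frobInner_sub_right]
    set a := frobInner (A k) X
    set b := frobInner (A k) Y
    by_cases hab : |a| ≤ 100 * ξ ∧ |b| ≤ 100 * ξ
    · refine le_trans ?_ (M.le_psi_bregman hab.1 hab.2)
      rw [← hBdef]
      refine mul_le_mul_of_nonneg_left ?_ (by positivity)
      have : 0 ≤ 25 * δ * ((a ^ 2 + b ^ 2) / (100 * ξ) ^ 2) := by positivity
      linarith [min_le_left ((b - a) ^ 2) (25 * δ)]
    · refine le_trans ?_ (M.psi_bregman_nonneg a b)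
      have h1 : 1 ≤ (a ^ 2 + b ^ 2) / (100 * ξ) ^ 2 := by
        rw [le_div_iff₀ (by positivity), one_mul]
        rcases not_and_or.1 hab with h2 | h2
        · have := pow_le_pow_left₀ (by positivity) (not_le.1 h2).le 2
          rw [sq_abs] at this
          linarith [sq_nonneg b]
        · have := pow_le_pow_left₀ (by positivity) (not_le.1 h2).le 2
          rw [sq_abs] at this
          linarith [sq_nonneg a]
      have h2 : 25 * δ ≤ 25 * δ * ((a ^ 2 + b ^ 2) / (100 * ξ) ^ 2) :=
        le_mul_of_one_le_right (by positivity) h1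
      refine mul_nonpos_of_nonneg_of_nonpos (by positivity) ?_
      linarith [min_le_right ((b - a) ^ 2) (25 * δ)]
  refine le_trans ?_ (Finset.sum_le_sum fun k _ => hpt k)
  rw [← Finset.mul_sum, Finset.sum_sub_distrib, ← Finset.mul_sum, ← Finset.sum_div,
    Finset.sum_add_distrib]
  have hsum : (∑ k, frobInner (A k) X ^ 2 + ∑ k, frobInner (A k) Y ^ 2) / (100 * ξ) ^ 2 ≤
      17 / 4 * n / 10000 := by
    rw [div_le_iff₀ (by positivity)]
    have h1 : frobNorm X ^ 2 ≤ ξ ^ 2 := pow_le_pow_left₀ (frobNorm_nonneg _) hX 2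
    have h2 : frobNorm Y ^ 2 ≤ ξ ^ 2 := pow_le_pow_left₀ (frobNorm_nonneg _) hY 2
    have h3 : 17 / 8 * n * frobNorm X ^ 2 ≤ 17 / 8 * n * ξ ^ 2 := by gcongr
    have h4 : 17 / 8 * n * frobNorm Y ^ 2 ≤ 17 / 8 * n * ξ ^ 2 := by gcongr
    calc _ ≤ 17 / 8 * n * ξ ^ 2 + 17 / 8 * n * ξ ^ 2 := by linarith
      _ = _ := by ring
  have h5 := mul_le_mul_of_nonneg_left hsum (show 0 ≤ 25 * δ by positivity)
  have h6 : 0 ≤ (n : ℝ) * δ := by positivity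
  have h7 : 3 / 5 * (n * δ) ≤ ∑ k, min (frobInner (A k) (Y - X) ^ 2) (25 * δ) - 25 * δ *
      ((∑ k, frobInner (A k) X ^ 2 + ∑ k, frobInner (A k) Y ^ 2) / (100 * ξ) ^ 2) := by
    linarith
  calc _ = B / 2 * (3 / 5 * (n * δ)) := by ring
    _ ≤ _ := mul_le_mul_of_nonneg_left h7 (by positivity)

end Loss


/-! ### Analysis of the averaged projected gradient method -/

section Algorithm

variable {d₁ d₂ : ℕ} {L : Matrix (Fin d₁) (Fin d₂) ℝ → ℝ} {r t₀ : ℕ} {η₀ β ξ : ℝ}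
  {X : ℕ → Matrix (Fin d₁) (Fin d₂) ℝ}

lemma stepSize_mem (hη0 : 0 < η₀) (hη1 : η₀ ≤ 1) (t : ℕ) :
    0 < stepSize η₀ t₀ t ∧ stepSize η₀ t₀ t ≤ 1 := by
  unfold stepSize
  split_ifs
  exacts [⟨one_pos, le_rfl⟩, ⟨hη0, hη1⟩]

lemma IsAVPG.mem_frobBall (hX : IsAVPG L (frobBall d₁ d₂ ξ) r η₀ β t₀ X) (hη0 : 0 < η₀)
    (hη1 : η₀ ≤ 1) (t : ℕ) : X (t + 1) ∈ frobBall d₁ d₂ ξ := by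
  obtain ⟨h0, -, h1, hstep⟩ := hX
  induction t with
  | zero => rw [h1]; exact h0
  | succ t ih =>
    obtain ⟨V, hV, hnext⟩ := hstep (t + 1) (by omega)
    obtain ⟨hs0, hs1⟩ := stepSize_mem (t₀ := t₀) hη0 hη1 (t + 1)
    have hVC : frobNorm V ≤ ξ := hV.2.1
    have hXC : frobNorm (X (t + 1)) ≤ ξ := ih
    change frobNorm (X (t + 1 + 1)) ≤ ξ
    rw [hnext]
    refine (frobNorm_add_le _ _).trans ?_
    rw [frobNorm_smul, frobNorm_smul, abs_of_nonneg (by linarith), abs_of_pos hs0]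
    nlinarith

/-- Averaging adds at most `r` to the rank, and a full step discards the past. Hence the induction
tracks the time since the last full step, `t % t₀`. -/
lemma IsAVPG.rank_le (hX : IsAVPG L (frobBall d₁ d₂ ξ) r η₀ β t₀ X) (ht₀ : 0 < t₀) (t : ℕ) :
    (X (t + 1)).rank ≤ t₀ * r := by
  suffices h : (X (t + 1)).rank ≤ (t % t₀ + 1) * r from
    h.trans (Nat.mul_le_mul_right r (Nat.mod_lt t ht₀))
  obtain ⟨-, h0, h1, hstep⟩ := hX
  induction t with
  | zero => rw [h1]; simpa using h0
  | succ t ih =>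
    obtain ⟨V, hV, hnext⟩ := hstep (t + 1) (by omega)
    rw [hnext]
    by_cases hdvd : t₀ ∣ t + 1
    · have : stepSize η₀ t₀ (t + 1) = 1 := by simp [stepSize, hdvd]
      rw [this]
      simp only [sub_self, zero_smul, zero_add, one_smul]
      exact hV.1.trans (Nat.le_mul_of_pos_left r (Nat.succ_pos _))
    · have hmod : (t + 1) % t₀ = t % t₀ + 1 := by
        have h2 : t % t₀ + 1 < t₀ := by
          refine lt_of_le_of_ne (Nat.mod_lt t ht₀) fun h => hdvd ?_
          exact (Nat.dvd_iff_mod_eq_zero).2 (by rw [← Nat.mod_add_mod, h, Nat.mod_self])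
        rw [← Nat.mod_add_mod, Nat.mod_eq_of_lt h2]
      rw [hmod]
      refine (rank_add_le _ _).trans ((add_le_add (rank_smul_le _ _) (rank_smul_le _ _)).trans ?_)
      calc _ ≤ (t % t₀ + 1) * r + r := add_le_add ih hV.1
        _ = _ := by ring

/-- Completing the square: up to a term independent of `V`, `β η²` times the squared distance to be
minimized is the quadratic upper model of the loss at `Y + η (V - Y)`. -/
lemma IsRegProj.inner_le {C : Set (Matrix (Fin d₁) (Fin d₂) ℝ)}
    {Y G V W : Matrix (Fin d₁) (Fin d₂) ℝ} {η : ℝ} (hβ : 0 < β) (hη : 0 < η)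
    (hV : IsRegProj r C (Y - (1 / (2 * β * η)) • G) V) (hW : W.rank ≤ r) (hWC : W ∈ C) :
    η * frobInner G (V - Y) + β * η ^ 2 * frobNorm (V - Y) ^ 2 ≤
      η * frobInner G (W - Y) + β * η ^ 2 * frobNorm (W - Y) ^ 2 := by
  have h := pow_le_pow_left₀ (frobNorm_nonneg _) (hV.2.2 W hW hWC) 2
  have e : ∀ U : Matrix (Fin d₁) (Fin d₂) ℝ, frobNorm (Y - (1 / (2 * β * η)) • G - U) ^ 2 =
      frobNorm (U - Y) ^ 2 + 2 * (1 / (2 * β * η)) * frobInner G (U - Y) +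
        (1 / (2 * β * η)) ^ 2 * frobNorm G ^ 2 := by
    intro U
    have : Y - (1 / (2 * β * η)) • G - U = (-1 : ℝ) • ((U - Y) + (1 / (2 * β * η)) • G) := by
      module
    rw [this, frobNorm_smul, abs_neg, abs_one, one_mul]
    simp only [frobNorm_eq_norm, frobInner_eq_inner, columns_add, columns_smul]
    rw [norm_add_sq_real, norm_smul, real_inner_smul_right, mul_pow, Real.norm_eq_abs, sq_abs,
      real_inner_comm]
    ring
  rw [e, e] at h
  have h2 := mul_le_mul_of_nonneg_left h (show 0 ≤ β * η ^ 2 by positivity)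
  have e2 : ∀ U : Matrix (Fin d₁) (Fin d₂) ℝ, β * η ^ 2 * (frobNorm (U - Y) ^ 2 +
      2 * (1 / (2 * β * η)) * frobInner G (U - Y) + (1 / (2 * β * η)) ^ 2 * frobNorm G ^ 2) =
      η * frobInner G (U - Y) + β * η ^ 2 * frobNorm (U - Y) ^ 2 +
        β * η ^ 2 * (1 / (2 * β * η)) ^ 2 * frobNorm G ^ 2 := by
    intro U; field_simp; ring
  rw [e2, e2] at h2
  linarith

/-- One iteration of the method, under restricted smoothness and strong convexity. -/
lemma IsAVPG.step_le {Xnat : Matrix (Fin d₁) (Fin d₂) ℝ} {α : ℝ}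
    (hX : IsAVPG L (frobBall d₁ d₂ ξ) r η₀ β t₀ X) (hη0 : 0 < η₀) (hη1 : η₀ ≤ 1) (hβ : 0 < β)
    (ht₀ : 0 < t₀) (hnat : Xnat.rank ≤ r) (hnatC : frobNorm Xnat ≤ ξ)
    (hsmooth : ∀ Y Z : Matrix (Fin d₁) (Fin d₂) ℝ, (Z - Y).rank ≤ (t₀ + 1) * r →
      L Z - L Y - frobInner (matGradient L Y) (Z - Y) ≤ β * frobNorm (Z - Y) ^ 2)
    (hconv : ∀ Y : Matrix (Fin d₁) (Fin d₂) ℝ, Y.rank ≤ t₀ * r → frobNorm Y ≤ ξ →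
      α * frobNorm (Xnat - Y) ^ 2 ≤ L Xnat - L Y - frobInner (matGradient L Y) (Xnat - Y))
    (t : ℕ) :
    L (X (t + 1 + 1)) - L Xnat ≤ (1 - stepSize η₀ t₀ (t + 1)) * (L (X (t + 1)) - L Xnat) +
      stepSize η₀ t₀ (t + 1) * (β * stepSize η₀ t₀ (t + 1) - α) *
        frobNorm (X (t + 1) - Xnat) ^ 2 := by
  have hmem := hX.mem_frobBall hη0 hη1 t
  have hrank := hX.rank_le ht₀ t
  obtain ⟨-, -, -, hstep⟩ := hX
  obtain ⟨V, hV, hnext⟩ := hstep (t + 1) (by omega)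
  obtain ⟨hs0, hs1⟩ := stepSize_mem (t₀ := t₀) hη0 hη1 (t + 1)
  set η := stepSize η₀ t₀ (t + 1)
  set Y := X (t + 1)
  have hdiff : X (t + 1 + 1) - Y = η • (V - Y) := by rw [hnext]; module
  have h1 := hsmooth Y (X (t + 1 + 1)) (by
    rw [hdiff]
    refine (rank_smul_le _ _).trans ((rank_sub_le _ _).trans ?_)
    calc _ ≤ r + t₀ * r := add_le_add hV.1 hrank
      _ = _ := by ring)
  rw [hdiff, frobInner_smul_right, frobNorm_smul, abs_of_pos hs0, mul_pow] at h1
  have h2 := hV.inner_le hβ hs0 hnat hnatC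
  have h3 := mul_le_mul_of_nonneg_left (hconv Y hrank hmem) hs0.le
  have h4 : frobNorm (Xnat - Y) = frobNorm (Y - Xnat) := by
    rw [show Xnat - Y = (-1 : ℝ) • (Y - Xnat) by module, frobNorm_smul, abs_neg, abs_one, one_mul]
  rw [h4] at h2 h3
  -- Chain: smoothness bounds the new value by the model at `V`, the projection replaces `V` by
  -- `Xnat`, and strong convexity bounds the linear term there.
  nlinarith

/-- Linear convergence of the method up to the noise level. -/
theorem IsAVPG.frobNorm_sub_sq_le {Xnat : Matrix (Fin d₁) (Fin d₂) ℝ} {Bs Bi κ N : ℝ}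
    (hBi : 0 < Bi) (hBs : Bi ≤ Bs) (hκ : κ = 1.1 * Bs / Bi) (ht₀ : 0 < t₀)
    (hX : IsAVPG L (frobBall d₁ d₂ ξ) r (1 / (4 * κ)) (17 / 16 * Bs) t₀ X)
    (hnat : Xnat.rank ≤ r) (hnatC : frobNorm Xnat ≤ ξ)
    (hsmooth : ∀ Y Z : Matrix (Fin d₁) (Fin d₂) ℝ, (Z - Y).rank ≤ (t₀ + 1) * r →
      L Z - L Y - frobInner (matGradient L Y) (Z - Y) ≤ 17 / 16 * Bs * frobNorm (Z - Y) ^ 2)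
    (hconv : ∀ Y : Matrix (Fin d₁) (Fin d₂) ℝ, Y.rank ≤ t₀ * r → frobNorm Y ≤ ξ →
      3 / 10 * Bi * frobNorm (Xnat - Y) ^ 2 ≤
        L Xnat - L Y - frobInner (matGradient L Y) (Xnat - Y))
    (hconv' : ∀ Y : Matrix (Fin d₁) (Fin d₂) ℝ, Y.rank ≤ t₀ * r → frobNorm Y ≤ ξ →
      3 / 10 * Bi * frobNorm (Y - Xnat) ^ 2 ≤
        L Y - L Xnat - frobInner (matGradient L Xnat) (Y - Xnat))
    (hnoise : ∀ Y : Matrix (Fin d₁) (Fin d₂) ℝ, Y.rank ≤ t₀ * r →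
      |frobInner (matGradient L Xnat) (Y - Xnat)| ≤ N * frobNorm (Y - Xnat))
    (t τs : ℕ) (hτs : τs ∈ Finset.Icc 1 (t + 1))
    (hbest : ∀ k ∈ Finset.Icc 1 (t + 1), L (X τs) ≤ L (X k)) :
    frobNorm (X τs - Xnat) ^ 2 ≤ 4 * Bi⁻¹ *
      max ((1 - 1 / (4 * κ)) ^ t * (4 * κ) ^ (t / t₀) * (L (X 0) - L Xnat))
        (1250 * N ^ 2 / Bi) := by
  have hBs0 : 0 < Bs := hBi.trans_le hBs
  have hκBi : κ * Bi = 1.1 * Bs := by rw [hκ]; field_simp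
  have hκ1 : 1.1 ≤ κ := by
    rw [hκ, le_div_iff₀ hBi]; linarith
  have hκ0 : 0 < κ := by linarith
  have hη0 : 0 < 1 / (4 * κ) := by positivity
  have hη1 : 1 / (4 * κ) ≤ 1 := by
    rw [div_le_one (by positivity)]; linarith
  set e := 1250 * N ^ 2 / Bi with he
  have he0 : 0 ≤ e := by positivity
  set h : ℕ → ℝ := fun k => L (X k) - L Xnat with hh
  set δ : ℕ → ℝ := fun k => frobNorm (X k - Xnat) ^ 2 with hδ
  have hδ0 : ∀ k, 0 ≤ δ k := fun k => sq_nonneg _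
  -- Strong convexity at `Xnat`, with the gradient term split by Young's inequality. The constant
  -- 1250 in `e` makes the difference there a perfect square.
  have hdist : ∀ k, 28 / 100 * Bi * δ (k + 1) ≤ h (k + 1) + e / 100 := by
    intro k
    have h1 := hconv' _ (hX.rank_le ht₀ k) (hX.mem_frobBall hη0 hη1 k)
    have h2 := hnoise _ (hX.rank_le ht₀ k)
    have h3 := neg_abs_le (frobInner (matGradient L Xnat) (X (k + 1) - Xnat))
    have h3' := le_abs_self (frobInner (matGradient L Xnat) (X (k + 1) - Xnat))
    have h4 : N * frobNorm (X (k + 1) - Xnat) ≤ 2 / 100 * Bi * δ (k + 1) + e / 100 := by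
      have h5 : 2 / 100 * Bi * δ (k + 1) + e / 100 - N * frobNorm (X (k + 1) - Xnat) =
          2 / 100 / Bi * (Bi * frobNorm (X (k + 1) - Xnat) - 25 * N) ^ 2 := by
        simp only [he, hδ]; field_simp; ring
      have h6 : 0 ≤ 2 / 100 / Bi * (Bi * frobNorm (X (k + 1) - Xnat) - 25 * N) ^ 2 := by
        positivity
      linarith
    simp only [hh, hδ] at h4 ⊢
    linarith
  have hstep := hX.step_le hη0 hη1 (by positivity) ht₀ hnat hnatC hsmooth hconv
  have hsmall : ∀ k, ¬ t₀ ∣ k + 1 → h (k + 1 + 1) ≤ (1 - 1 / (4 * κ)) * h (k + 1) := by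
    intro k hk
    have h1 := hstep k
    have h2 : stepSize (1 / (4 * κ)) t₀ (k + 1) = 1 / (4 * κ) := by simp [stepSize, hk]
    rw [h2] at h1
    -- For the small step the distance term has a nonpositive coefficient: `Bs / κ = Bi / 1.1` makes
    -- the first summand about `0.24 Bi`.
    have h3 : 17 / 16 * Bs * (1 / (4 * κ)) - 3 / 10 * Bi ≤ 0 := by
      rw [sub_nonpos, mul_one_div, div_le_iff₀ (by positivity)]
      nlinarith
    have h4 : 1 / (4 * κ) * (17 / 16 * Bs * (1 / (4 * κ)) - 3 / 10 * Bi) * δ (k + 1) ≤ 0 :=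
      mul_nonpos_of_nonpos_of_nonneg (mul_nonpos_of_nonneg_of_nonpos hη0.le h3) (hδ0 _)
    simp only [hδ] at h4
    simp only [hh]
    linarith
  have hbig : ∀ k, t₀ ∣ k + 1 → e ≤ h (k + 1) → h (k + 1 + 1) ≤ (4 * κ - 1) * h (k + 1) := by
    intro k hk hek
    have h1 := hstep k
    have h2 : stepSize (1 / (4 * κ)) t₀ (k + 1) = 1 := by simp [stepSize, hk]
    rw [h2] at h1
    have h3 := hdist k
    have h4 : h (k + 1 + 1) ≤ (17 / 16 * Bs - 3 / 10 * Bi) * δ (k + 1) := by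
      simp only [hh, hδ]; linarith
    have h5 : Bi * δ (k + 1) ≤ 101 / 28 * h (k + 1) := by linarith
    have h6 : (17 / 16 * Bs - 3 / 10 * Bi) * δ (k + 1) =
        (17 / 17.6 * κ - 3 / 10) * (Bi * δ (k + 1)) := by
      have : Bs = κ * Bi / 1.1 := by rw [hκBi]; ring
      rw [this]; ring
    have h7 : 0 ≤ h (k + 1) := he0.trans hek
    have h8 : (17 / 17.6 * κ - 3 / 10) * (Bi * δ (k + 1)) ≤
        (17 / 17.6 * κ - 3 / 10) * (101 / 28 * h (k + 1)) :=
      mul_le_mul_of_nonneg_left h5 (by linarith)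
    have h9 : (17 / 17.6 * κ - 3 / 10) * (101 / 28) ≤ 4 * κ - 1 := by linarith
    have h10 := mul_le_mul_of_nonneg_right h9 h7
    linarith
  have hρ : 0 ≤ 1 - 1 / (4 * κ) := by linarith
  have hprod : ∀ k, (∀ j ∈ Finset.Icc 1 (k + 1), e ≤ h j) →
      h (k + 1) ≤ (1 - 1 / (4 * κ)) ^ k * (4 * κ) ^ (k / t₀) * h 0 := by
    intro k
    induction k with
    | zero => intro _; simp [hh, hX.2.2.1]
    | succ k ih =>
      intro hj
      have ih' := ih fun j hj' => hj j (by
        rw [Finset.mem_Icc] at hj' ⊢; omega)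
      have hek := hj (k + 1) (by rw [Finset.mem_Icc]; omega)
      by_cases hk : t₀ ∣ k + 1
      · rw [Nat.succ_div_of_dvd hk]
        have h1 := mul_le_mul_of_nonneg_left ih' (show 0 ≤ 4 * κ - 1 by linarith)
        refine (hbig k hk hek).trans (h1.trans (le_of_eq ?_))
        rw [pow_succ, pow_succ, show 4 * κ - 1 = (1 - 1 / (4 * κ)) * (4 * κ) by field_simp]
        ring
      · rw [Nat.succ_div_of_not_dvd hk]
        have h1 := mul_le_mul_of_nonneg_left ih' hρ
        refine (hsmall k hk).trans (h1.trans (le_of_eq ?_))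
        rw [pow_succ]; ring
  have hτ1 := Finset.mem_Icc.1 hτs
  obtain ⟨k, rfl⟩ : ∃ k, τs = k + 1 := ⟨τs - 1, by omega⟩
  have hd := hdist k
  set m := max ((1 - 1 / (4 * κ)) ^ t * (4 * κ) ^ (t / t₀) * (L (X 0) - L Xnat)) e with hm
  have hem : e ≤ m := le_max_right _ _
  have hkm : h (k + 1) ≤ m := by
    -- Either the product bound reaches step `t + 1`, or some iterate is already below the floor;
    -- the best iterate is no worse in both cases.
    by_cases hall : ∀ j ∈ Finset.Icc 1 (t + 1), e ≤ h j
    · have h1 := hprod t hall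
      have h2 := hbest (t + 1) (by rw [Finset.mem_Icc]; omega)
      have h3 := le_max_left
        ((1 - 1 / (4 * κ)) ^ t * (4 * κ) ^ (t / t₀) * (L (X 0) - L Xnat)) e
      simp only [hh] at h1 ⊢
      linarith
    · push Not at hall
      obtain ⟨j, hj, hje⟩ := hall
      have h2 := hbest j hj
      simp only [hh] at hje ⊢
      linarith
  have hfin : Bi * δ (k + 1) ≤ 4 * m := by nlinarith
  calc δ (k + 1) = Bi⁻¹ * (Bi * δ (k + 1)) := by field_simp
    _ ≤ Bi⁻¹ * (4 * m) := mul_le_mul_of_nonneg_left hfin (by positivity)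
    _ = 4 * Bi⁻¹ * m := by ring

end Algorithm

/-! ### Size of the period and of the noise floor -/

lemma period_add_one_le {κ : ℝ} (hκ : 1.1 ≤ κ) :
    ((period κ + 1 : ℕ) : ℝ) ≤ 100 * (κ * Real.log κ) := by
  have h0 : 0 < κ := by linarith
  -- The factor 1.1 in `κ` keeps `log κ` away from 0, so that `log 4` and the additive constants can
  -- be absorbed into `κ log κ`.
  have hl : 1 / 11 ≤ Real.log κ := by
    have h1 := Real.one_sub_inv_le_log_of_pos (x := 1.1) (by norm_num)
    have h2 := Real.log_le_log (by norm_num) hκ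
    norm_num at h1 h2 ⊢
    linarith
  have h4 : Real.log 4 ≤ 1.4 := by
    rw [show (4 : ℝ) = 2 ^ 2 by norm_num, Real.log_pow]
    have := Real.log_two_lt_d9
    norm_num at this ⊢
    linarith
  have hlog : Real.log (4 * κ) = Real.log 4 + Real.log κ :=
    Real.log_mul (by norm_num) h0.ne'
  have hc := Nat.ceil_lt_add_one (a := 4 * κ * Real.log (4 * κ)) (by
    rw [hlog]
    have : 0 ≤ Real.log 4 := Real.log_nonneg (by norm_num)
    positivity)
  unfold period
  push_cast
  have h5 : Real.log (4 * κ) ≤ 16.4 * Real.log κ := by rw [hlog]; linarith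
  have h6 : 4 * κ * Real.log (4 * κ) ≤ 4 * κ * (16.4 * Real.log κ) := by gcongr
  have h7 : 0.1 ≤ κ * Real.log κ := by nlinarith
  linarith


lemma eq_zero_of_rank_eq_zero {d₁ d₂ : ℕ} {X : Matrix (Fin d₁) (Fin d₂) ℝ} (hX : X.rank = 0) :
    X = 0 := by
  have h := hX
  unfold Matrix.rank at h
  rw [Submodule.finrank_eq_zero, LinearMap.range_eq_bot] at h
  ext i j
  have := congrFun (congrArg (fun f => f (Pi.single j 1)) h) i
  simpa using this

lemma Model.le_kappa (M : Model) {R : ℝ} (hR : 0 ≤ R) : 1.1 ≤ M.kappa R := by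
  rw [Model.kappa, le_div_iff₀ (M.Binf_pos hR)]
  linarith [M.Binf_le_Bsup hR]

/-- The noise floor of the method, in terms of `κ`. -/
lemma noise_floor_le {Bs Bi κ c r d n t : ℝ} (hBi : 0 < Bi) (hBs : 1 / 4 ≤ Bs)
    (hκ : κ = 1.1 * Bs / Bi) (hκ1 : 1.1 ≤ κ) (hc : 0 ≤ c) (hr : 0 ≤ r) (hd : 0 ≤ d) (hn : 0 < n)
    (ht0 : 0 ≤ t) (ht : t ≤ 100 * (κ * Real.log κ)) :
    1250 * (10 * √(c * n * (t * r * d)) / n) ^ 2 / Bi ≤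
      50000000 * (κ ^ 3 * r * Real.log κ * c * (d / n)) := by
  -- Since `Bs ≥ 1/4`, the inverse curvature costs at most powers of `κ`; with the `κ log κ` from
  -- the period this gives `κ³ log κ`.
  have hinv : Bi⁻¹ ≤ 4 * κ ^ 2 := by
    have h1 : 1.1 * Bs = κ * Bi := by rw [hκ]; field_simp
    rw [inv_le_iff_one_le_mul₀ hBi]
    nlinarith
  have e : 1250 * (10 * √(c * n * (t * r * d)) / n) ^ 2 / Bi =
      125000 * (c * r * (d / n)) * (t * Bi⁻¹) := by
    rw [div_pow, mul_pow, Real.sq_sqrt (by positivity)]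
    field_simp
    ring
  rw [e]
  have h2 : t * Bi⁻¹ ≤ 100 * (κ * Real.log κ) * (4 * κ ^ 2) := by
    gcongr
    exact ht0.trans ht
  calc _ ≤ 125000 * (c * r * (d / n)) * (100 * (κ * Real.log κ) * (4 * κ ^ 2)) := by gcongr
    _ = _ := by ring

end RGLM

/-! ### The main theorem -/

theorem mainTheorem3 :
    ∃ c c₀ c₁ c₂ : ℝ, 0 < c ∧ 0 < c₀ ∧ 0 < c₁ ∧ 0 < c₂ ∧
      ∀ (M : RGLM.Model) (d₁ d₂ n : ℕ) (Xnat : Matrix (Fin d₁) (Fin d₂) ℝ) (τ : ℝ) (_ : 1 ≤ τ)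
        (R Bsup Binf κ d : ℝ)
        (_ : R = √(2.4 / c₀) * τ * RGLM.frobNorm Xnat)
        (_ : Bsup = M.Bsup) (_ : Binf = M.Binf R) (_ : κ = M.kappa R)
        (_ : d = ((max d₁ d₂ : ℕ) : ℝ))
        (_ : c₂ * ((⌈κ * Real.log κ⌉ : ℝ) + 1) * (Xnat.rank : ℝ) * d ≤ (n : ℝ))
        (Ω : Type*) [MeasurableSpace Ω] (P : MeasureTheory.Measure Ω)
        [MeasureTheory.IsProbabilityMeasure P]
        (A : Fin n → Ω → Matrix (Fin d₁) (Fin d₂) ℝ) (y : Fin n → Ω → ℝ)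
        (_ : ∀ i, ProbabilityTheory.HasLaw (fun ω => (A i ω, y i ω))
          (RGLM.observationLaw M Xnat) P)
        (_ : ProbabilityTheory.iIndepFun (fun i ω => (A i ω, y i ω)) P),
        ∃ E : Set Ω, MeasurableSet E ∧ ENNReal.ofReal (1 - Real.exp (-c₁ * d)) ≤ P E ∧
          ∀ ω ∈ E, ∀ L : Matrix (Fin d₁) (Fin d₂) ℝ → ℝ,
            L = RGLM.loss M (fun i => A i ω) (fun i => y i ω) →
            ∀ X : ℕ → Matrix (Fin d₁) (Fin d₂) ℝ,
              RGLM.IsAVPG L (RGLM.frobBall d₁ d₂ (τ * RGLM.frobNorm Xnat)) Xnat.rank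
                (1 / (4 * κ)) (17 / 16 * Bsup) (RGLM.period κ) X →
              ∀ t s τs : ℕ, IsGreatest {k : ℕ | k * RGLM.period κ ≤ t} s →
                τs ∈ Finset.Icc 1 (t + 1) →
                (∀ k ∈ Finset.Icc 1 (t + 1), L (X τs) ≤ L (X k)) →
                RGLM.frobNorm (X τs - Xnat) ^ 2 ≤
                  c * Binf⁻¹ * max ((1 - 1 / (4 * κ)) ^ t * (4 * κ) ^ s * (L (X 0) - L Xnat))
                    (κ ^ 3 * (Xnat.rank : ℝ) * Real.log κ * M.noise * (d / (n : ℝ))) := by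
  -- `c = 4 * 50000000` combines the optimization bound with the noise floor; `c₀` makes `√(2.4 /
  -- c₀) = 100`; `c₂ = 1500 * 100` combines the sample size of the good event with the bound on the
  -- period.
  refine ⟨200000000, 2.4 / 10000, 1, 150000, by norm_num, by norm_num, by norm_num, by norm_num, ?_⟩
  intro M d₁ d₂ n Xnat τ hτ R Bsup Binf κ d hR hBsup hBinf hκ hd hn Ω _ P _ A y hlaw hind
  set ξ := τ * RGLM.frobNorm Xnat with hξ
  have hRξ : R = 100 * ξ := by
    rw [hR, show (2.4 / (2.4 / 10000) : ℝ) = 100 ^ 2 by norm_num, Real.sqrt_sq (by norm_num),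
      mul_assoc]
  have hnat0 := RGLM.frobNorm_nonneg Xnat
  have hξ0 : 0 ≤ ξ := mul_nonneg (by linarith) hnat0
  have hR0 : 0 ≤ R := by rw [hRξ]; positivity
  have hκ1 : 1.1 ≤ κ := hκ ▸ M.le_kappa hR0
  have hBi : 0 < Binf := hBinf ▸ M.Binf_pos hR0
  have hBs4 : 1 / 4 ≤ Bsup := hBsup ▸ M.quarter_le_Bsup
  have hBs : Binf ≤ Bsup := by rw [hBsup, hBinf]; exact M.Binf_le_Bsup hR0
  have hκ' : κ = 1.1 * Bsup / Binf := by rw [hκ, hBsup, hBinf]; rfl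
  have hκ0 : 0 < κ := by linarith
  have hlog : 0 ≤ Real.log κ := Real.log_nonneg (by linarith)
  have hd0 : 0 ≤ d := hd ▸ Nat.cast_nonneg _
  have hη0 : 0 < 1 / (4 * κ) := by positivity
  have hη1 : 1 / (4 * κ) ≤ 1 := by
    rw [div_le_one (by positivity)]; linarith
  have hc := M.noise_nonneg
  have ht₀ : 0 < RGLM.period κ := Nat.succ_pos _
  -- In rank 0 the ball is `{0}` and all iterates from `X 1` on vanish. This case is separate
  -- because it allows `n = 0`, and strong convexity needs `ξ > 0`.
  rcases Nat.eq_zero_or_pos Xnat.rank with hr | hr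
  · have hX0 := RGLM.eq_zero_of_rank_eq_zero hr
    have hξz : ξ = 0 := by rw [hξ, RGLM.frobNorm_eq_zero.2 hX0, mul_zero]
    refine ⟨Set.univ, MeasurableSet.univ, ?_, ?_⟩
    · rw [measure_univ]
      refine ENNReal.ofReal_le_one.2 ?_
      linarith [Real.exp_pos (-1 * d)]
    · intro ω _ L _ X hX t s τs _ hτs _
      obtain ⟨k, rfl⟩ : ∃ k, τs = k + 1 := ⟨τs - 1, by have := Finset.mem_Icc.1 hτs; omega⟩
      have hk : RGLM.frobNorm (X (k + 1)) ≤ ξ := hX.mem_frobBall hη0 hη1 k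
      have hk0 : RGLM.frobNorm (X (k + 1)) = 0 :=
        le_antisymm (hξz ▸ hk) (RGLM.frobNorm_nonneg _)
      rw [hX0, sub_zero, hk0]
      refine le_trans (by norm_num) (mul_nonneg (by positivity) (le_max_of_le_right ?_))
      positivity
  · set r := Xnat.rank with hrdef
    have hr1 : (1 : ℝ) ≤ r := by exact_mod_cast hr
    have hdim : 1 ≤ max d₁ d₂ := by
      have := Matrix.rank_le_width Xnat
      exact le_max_of_le_right (by omega)
    have hd1 : 1 ≤ d := by rw [hd]; exact_mod_cast hdim
    have hper := RGLM.period_add_one_le hκ1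
    -- Iterates have rank at most `t₀ r`; subtracting `X♮` or an oracle value adds `r`.
    set q := (RGLM.period κ + 1) * r with hq
    have hqd : 1500 * ((q : ℝ) * (max d₁ d₂ : ℕ)) ≤ n := by
      refine le_trans ?_ hn
      rw [← hd, hq, Nat.cast_mul]
      have h1 := Int.le_ceil (κ * Real.log κ)
      calc _ ≤ 1500 * ((100 * ((⌈κ * Real.log κ⌉ : ℝ) + 1)) * r * d) := by
            gcongr
            linarith
        _ = _ := by ring
    have hn0 : 0 < n := by
      have h1 : (1 : ℝ) ≤ q := by
        rw [hq]; exact_mod_cast Nat.mul_pos (Nat.succ_pos _) hr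
      have h2 : (0 : ℝ) < n := by
        refine lt_of_lt_of_le ?_ hqd
        rw [← hd]; positivity
      exact_mod_cast h2
    have hn' : (0 : ℝ) < n := Nat.cast_pos.2 hn0
    have hξpos : 0 < ξ := by
      refine mul_pos (by linarith) (lt_of_le_of_ne hnat0 fun h => ?_)
      rw [RGLM.frobNorm_eq_zero.1 h.symm, Matrix.rank_zero] at hrdef
      omega
    obtain ⟨E, hE, hPE, hgood⟩ := RGLM.exists_good_event hlaw hind (q := q)
      (Nat.mul_pos (Nat.succ_pos _) hr) hdim hqd
    refine ⟨E, hE, by rw [neg_one_mul, hd]; exact hPE, ?_⟩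
    intro ω hω L hL X hX t s τs hs hτs hbest
    have hgω := hgood ω hω
    have hst : s = t / RGLM.period κ := by
      refine le_antisymm ((Nat.le_div_iff_mul_le ht₀).2 hs.1) (hs.2 ?_)
      exact Nat.div_mul_le_self t _
    have hnatC : RGLM.frobNorm Xnat ≤ ξ := le_mul_of_one_le_left hnat0 hτ
    have hrq : r ≤ q := Nat.le_mul_of_pos_left r (Nat.succ_pos _)
    have htq : RGLM.period κ * r ≤ q := Nat.mul_le_mul_right r (Nat.le_succ _)
    have hsub : ∀ Y : Matrix (Fin d₁) (Fin d₂) ℝ, Y.rank ≤ RGLM.period κ * r →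
        (Y - Xnat).rank ≤ q ∧ (Xnat - Y).rank ≤ q := by
      intro Y hY
      have e : q = RGLM.period κ * r + r := by rw [hq]; ring
      constructor
      · exact (RGLM.rank_sub_le _ _).trans (by omega)
      · exact (RGLM.rank_sub_le _ _).trans (by omega)
    have hmain := hX.frobNorm_sub_sq_le (Xnat := Xnat) (Bs := Bsup) (Bi := Binf) (κ := κ)
      (N := 10 * √(M.noise * n * (q * (max d₁ d₂ : ℕ))) / n) hBi hBs hκ' ht₀ le_rfl hnatC
      (fun Y Z hYZ => by
        rw [hL, hBsup]
        exact RGLM.loss_bregman_le M hn0 _ _ Y Z (hgω _ hYZ).1)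
      (fun Y hY hYC => by
        rw [hL, hBinf, hRξ]
        exact RGLM.le_loss_bregman M hn0 _ _ hξpos Y Xnat hYC hnatC (hgω _ (hY.trans htq)).1
          (hgω _ hrq).1 (hgω _ (hsub Y hY).2).2.1)
      (fun Y hY hYC => by
        rw [hL, hBinf, hRξ]
        exact RGLM.le_loss_bregman M hn0 _ _ hξpos Xnat Y hnatC hYC (hgω _ hrq).1
          (hgω _ (hY.trans htq)).1 (hgω _ (hsub Y hY).1).2.1)
      (fun Y hY => by
        have h1 := (hgω _ (hsub Y hY).1).2.2
        rw [hL, RGLM.frobInner_matGradient_loss, abs_mul, abs_of_pos (by positivity), one_div,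
          inv_mul_le_iff₀ hn', ← abs_neg, ← Finset.sum_neg_distrib]
        simp only [← neg_mul, neg_sub]
        refine h1.trans (le_of_eq ?_)
        field_simp)
      t τs hτs hbest
    rw [← hst] at hmain
    have hfloor := RGLM.noise_floor_le (n := n) (r := r) (d := d) hBi hBs4 hκ' hκ1 hc
      (Nat.cast_nonneg _) hd0 hn' (Nat.cast_nonneg _) hper
    rw [← Nat.cast_mul, ← hq, hd, ← hd] at hfloor
    refine hmain.trans ?_
    set a := (1 - 1 / (4 * κ)) ^ t * (4 * κ) ^ s * (L (X 0) - L Xnat)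
    set b := κ ^ 3 * (r : ℝ) * Real.log κ * M.noise * (d / (n : ℝ)) with hb
    have hb0 : 0 ≤ b := by positivity
    have hmax0 : 0 ≤ max a b := le_max_of_le_right hb0
    have hmm : max a (1250 * (10 * √(M.noise * n * (q * (max d₁ d₂ : ℕ))) / n) ^ 2 / Binf) ≤
        50000000 * max a b := by
      refine max_le ?_ ?_
      · linarith [le_max_left a b]
      · rw [← hd]
        exact hfloor.trans (mul_le_mul_of_nonneg_left (le_max_right a b) (by norm_num))
    calc _ ≤ 4 * Binf⁻¹ * (50000000 * max a b) :=
          mul_le_mul_of_nonneg_left hmm (by positivity)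
      _ = _ := by ring
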